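/- Let $T>0$, let $b:[0,T]\to\mathbb R^{m\times m}$ and $\sigma:[0,T]\to\mathbb R^{m\times d}$ be deterministic continuous functions, let $B$ be a $d$-dimensional standard Brownian motion on a probability space, and let $X_0\sim p_{\mathrm{data}}$ be an $\mathbb R^m$-valued random variable independent of $B$, where $p_{\mathrm{data}}$ is an arbitrary probability measure on $\mathbb R^m$. Let $X$ be a solution with continuous paths of the linear stochastic differential equation $$dX_t=b(t)X_t\,dt+\sigma(t)\,dB_t,\qquad 0\le t\le T,$$ with initial value $X_0$. Let $Y:[0,T]\to\mathbb R^{m\times m}$ be the first variation process, that is, the solution of $dY_t=b(t)Y_t\,dt$, $Y_0=I_m$, and put $$\gamma_{X_T}=Y_T\Big(\int_0^T Y_r^{-1}\sigma(r)\sigma(r)^\top (Y_r^{-1})^\top\,dr\Big)Y_T^\top .$$ Assume that the matrix $\gamma_{X_T}$ is invertible. Then the law of $X_T$ has a density $p$ with respect to Lebesgue measure on $\mathbb R^m$ that is $C^\infty$ and everywhere strictly positive, and for Lebesgue-almost every $y\in\mathbb R^m$ the conditional expectation $\mathbb E[X_0\mid X_T=y]$ (the mean of the regular conditional distribution of $X_0$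 given $X_T=y$) exists and $$\nabla_y\log p(y)=-\gamma_{X_T}^{-1}\big(y-Y_T\,\mathbb E[X_0\mid X_T=y]\big).$$ -/

import Mathlib

open MeasureTheory ProbabilityTheory Matrix
open scoped NNReal ENNReal

namespace LinearSDE

/-- A `d`-dimensional standard Brownian motion: independent components, each of which is a
one-dimensional standard Brownian motion. -/
structure IsStdBrownianMotion {Ω : Type*} [MeasurableSpace Ω] {d : ℕ}
    (B : Fin d → ℝ≥0 → Ω → ℝ) (P : Measure Ω) : Prop where
  isBrownianReal : ∀ j, IsBrownianReal (B j) P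
  indep : iIndepFun (fun (j : Fin d) (ω : Ω) (t : ℝ≥0) => B j t ω) P

/-- A deterministic step integrand `∑ k, coef k • 1_{(left k, right k]}` supported in `(0, t]`.
The intervals are allowed to overlap. -/
structure StepIntegrand (t : ℝ) where
  card : ℕ
  coef : Fin card → ℝ
  left : Fin card → ℝ≥0
  right : Fin card → ℝ≥0
  left_le_right : ∀ k, left k ≤ right k
  right_le : ∀ k, (right k : ℝ) ≤ t

/-- The step integrand as a function of time. -/
noncomputable def StepIntegrand.toFun {t : ℝ} (g : StepIntegrand t) (s : ℝ) : ℝ :=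
  ∑ k, g.coef k * (Set.Ioc (g.left k : ℝ) (g.right k : ℝ)).indicator (fun _ => (1 : ℝ)) s

/-- The elementary stochastic integral `∑ k, coef k * (W (right k) - W (left k))` of a step
integrand against the process `W`. -/
noncomputable def StepIntegrand.integral {Ω : Type*} {t : ℝ} (g : StepIntegrand t)
    (W : ℝ≥0 → Ω → ℝ) (ω : Ω) : ℝ :=
  ∑ k, g.coef k * (W (g.right k) ω - W (g.left k) ω)

/-- `I` is (a version of) the stochastic integral `∫_0^t f(s) dW_s` of the deterministic function
`f` against the one-dimensional Brownian motion `W`: it is the limit in `L²(P)` of the elementary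
integrals of step integrands that approximate `f` in `L²((0, t])`. By the Itô isometry such an `I`
is unique up to almost sure equality. -/
def IsItoIntegral {Ω : Type*} [MeasurableSpace Ω] (P : Measure Ω) (W : ℝ≥0 → Ω → ℝ)
    (f : ℝ → ℝ) (t : ℝ) (I : Ω → ℝ) : Prop :=
  MemLp I 2 P ∧ ∀ ε : ℝ≥0∞, 0 < ε → ∃ g : StepIntegrand t,
    eLpNorm (fun s => f s - g.toFun s) 2 (volume.restrict (Set.Ioc 0 t)) ≤ ε ∧
    eLpNorm (fun ω => I ω - g.integral W ω) 2 P ≤ ε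

/-- `X` is a solution on `[0, T]` of `dX_t = b(t) X_t dt + σ(t) dB_t`: a process with almost surely
continuous paths such that, for every `t ∈ [0, T]`, almost surely
`X_t = X_0 + ∫_0^t b(s) X_s ds + ∫_0^t σ(s) dB_s`. The `i`-th coordinate of the last term is
`∑ j, ∫_0^t σ(s) i j dB^j_s`. -/
structure IsSolution {Ω : Type*} [MeasurableSpace Ω] {m d : ℕ} (P : Measure Ω)
    (B : Fin d → ℝ≥0 → Ω → ℝ) (b : ℝ → Matrix (Fin m) (Fin m) ℝ)
    (σ : ℝ → Matrix (Fin m) (Fin d) ℝ) (T : ℝ)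
    (X : ℝ → Ω → EuclideanSpace ℝ (Fin m)) : Prop where
  aemeasurable : ∀ t ∈ Set.Icc 0 T, AEMeasurable (X t) P
  continuousOn : ∀ᵐ ω ∂P, ContinuousOn (fun t => X t ω) (Set.Icc 0 T)
  equation : ∀ t ∈ Set.Icc 0 T, ∃ I : Fin m → Fin d → Ω → ℝ,
    (∀ i j, IsItoIntegral P (B j) (fun s => σ s i j) t (I i j)) ∧
    ∀ᵐ ω ∂P, X t ω = X 0 ω + (∫ s in (0 : ℝ)..t, toEuclideanLin (b s) (X s ω))
      + WithLp.toLp 2 (fun i => ∑ j, I i j ω)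

/-- `Y` is the first variation process on `[0, T]`: `dY_t = b(t) Y_t dt`, `Y_0 = I`. -/
structure IsFirstVariation {m : ℕ} (b : ℝ → Matrix (Fin m) (Fin m) ℝ) (T : ℝ)
    (Y : ℝ → Matrix (Fin m) (Fin m) ℝ) : Prop where
  zero : Y 0 = 1
  deriv : ∀ t ∈ Set.Icc 0 T, ∀ i j,
    HasDerivWithinAt (fun s => Y s i j) ((b t * Y t) i j) (Set.Icc 0 T) t

/-- The matrix `Y_T (∫_0^T Y_r⁻¹ σ(r) σ(r)ᵀ (Y_r⁻¹)ᵀ dr) Y_Tᵀ`, with the entrywise integral. -/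
noncomputable def gammaMatrix {m d : ℕ} (σ : ℝ → Matrix (Fin m) (Fin d) ℝ) (T : ℝ)
    (Y : ℝ → Matrix (Fin m) (Fin m) ℝ) : Matrix (Fin m) (Fin m) ℝ :=
  Y T * (Matrix.of fun i j =>
    ∫ r in (0 : ℝ)..T, ((Y r)⁻¹ * σ r * (σ r)ᵀ * ((Y r)⁻¹)ᵀ) i j) * (Y T)ᵀ

end LinearSDE

/-!
Variation of constants gives `X_T = Y_T X_0 + G`, where `G = ∫_0^T Y_T Y_r⁻¹ σ(r) dB_r` is a
centered Gaussian vector with covariance `γ`, independent of `X_0`. The density of `X_T` is then the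
Gaussian mixture `p(y) = ∫ q(y - Y_T x) p_data(dx)`, with `q` the density of `N(0, γ)`. As
`∇q(z) = -γ⁻¹ z q(z)`, differentiating under the integral sign and dividing by `p(y)` yields
`∇ log p(y) = -γ⁻¹ (y - Y_T E[X_0 | X_T = y])`, because the conditional law of `X_0` given `X_T = y`
has density `x ↦ q(y - Y_T x) / p(y)` with respect to `p_data`.

No Itô calculus is needed for the first step. The path `N_t = X_t - X_0 - ∫_0^t b(s) X_s ds` is
continuous, and `N_t` is almost surely the stochastic integral `∫_0^t σ dB`. Solving the linear
equation path by path (`IsFirstVariation.eq_of_path`) gives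
`G = N_T + ∫_0^T Y_T Y_s⁻¹ b(s) N_s ds`. The Riemann sums of the last integral are stochastic
integrals of explicit deterministic functions; these are Gaussian and independent of `X_0`, with
variance given by the Itô isometry (`integral_cexp_add_sum_ito`). The integrands converge to
`Y_T Y_r⁻¹ σ(r)`, thanks to `∫_r^T Y_T Y_s⁻¹ b(s) ds = Y_T Y_r⁻¹ - 1`, so that the joint
characteristic function of `X_0` and `G` passes to the limit (`integral_cexp_add_functional`,
`IsSolution.map_pair`).

For the second step `γ = L L*` and `G` is replaced by `L ξ` with `ξ` standard Gaussian. Smoothness of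
`p` comes from writing the Gaussian function as a characteristic function, which exhibits `p` as the
Fourier transform of a bounded function against a Gaussian measure
(`contDiff_integral_exp_neg_sq_norm_sub`). The score formula is `exists_density_of_map_eq`.
-/

namespace LinearSDE

open Filter Topology

/-! ### Gaussian law of stochastic integrals of deterministic functions -/

namespace StepIntegrand

variable {t T : ℝ}

lemma measurable_toFun (g : StepIntegrand t) : Measurable g.toFun := by
  unfold toFun
  refine Finset.measurable_sum _ fun k _ => Measurable.const_mul ?_ _
  exact measurable_const.indicator measurableSet_Ioc

lemma memLp_toFun (g : StepIntegrand t) (p : ℝ≥0∞) (μ : Measure ℝ) [IsFiniteMeasure μ] :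
    MemLp g.toFun p μ := by
  refine MemLp.of_bound g.measurable_toFun.aestronglyMeasurable (∑ k, |g.coef k|)
    (Eventually.of_forall fun s => ?_)
  unfold toFun
  refine (norm_sum_le _ _).trans (Finset.sum_le_sum fun k _ => ?_)
  rw [norm_mul, Real.norm_eq_abs]
  refine mul_le_of_le_one_right (abs_nonneg _) ?_
  by_cases h : s ∈ Set.Ioc (g.left k : ℝ) (g.right k : ℝ) <;> simp [h]

lemma measurable_integral_eval (g : StepIntegrand t) :
    Measurable (fun w : ℝ≥0 → ℝ => ∑ k, g.coef k * (w (g.right k) - w (g.left k))) :=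
  by fun_prop

end StepIntegrand

/-- The right-hand side is the covariance of the increments of Brownian motion over `(a, b]` and
`(c, d]`; both sides are the length of the overlap of these intervals. -/
lemma setIntegral_indicator_mul_indicator {T : ℝ} {a b c d : ℝ≥0} (hab : a ≤ b) (hcd : c ≤ d)
    (hb : (b : ℝ) ≤ T) :
    ∫ s in Set.Ioc 0 T, (Set.Ioc (a : ℝ) b).indicator (fun _ => (1 : ℝ)) s *
        (Set.Ioc (c : ℝ) d).indicator (fun _ => (1 : ℝ)) s
      = ((min b d : ℝ≥0) : ℝ) - (min b c : ℝ≥0) - (min a d : ℝ≥0) + (min a c : ℝ≥0) := by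
  have h1 : (fun s : ℝ => (Set.Ioc (a : ℝ) b).indicator (fun _ => (1 : ℝ)) s *
        (Set.Ioc (c : ℝ) d).indicator (fun _ => (1 : ℝ)) s)
      = (Set.Ioc (max a c : ℝ) (min b d)).indicator (fun _ => (1 : ℝ)) := by
    ext s
    rw [← Set.Ioc_inter_Ioc]
    by_cases h : s ∈ Set.Ioc (a : ℝ) b <;> by_cases h' : s ∈ Set.Ioc (c : ℝ) d <;>
      simp [h, h']
  have h2 : Set.Ioc 0 T ∩ Set.Ioc (max a c : ℝ) (min b d) = Set.Ioc (max a c : ℝ) (min b d) := by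
    refine Set.inter_eq_right.2 fun s hs => ⟨?_, ?_⟩
    · exact lt_of_le_of_lt ((NNReal.coe_nonneg a).trans (le_max_left _ _)) hs.1
    · exact hs.2.trans ((min_le_left _ _).trans hb)
  rw [h1, setIntegral_indicator measurableSet_Ioc, h2, setIntegral_const, Real.volume_real_Ioc]
  have hab' : (a : ℝ) ≤ b := hab
  have hcd' : (c : ℝ) ≤ d := hcd
  simp only [NNReal.coe_min, smul_eq_mul, mul_one]
  rcases le_total (a : ℝ) c with h1 | h1 <;> rcases le_total (b : ℝ) d with h2 | h2 <;>
    rcases le_total (b : ℝ) c with h3 | h3 <;> rcases le_total (a : ℝ) d with h4 | h4 <;>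
    simp only [h1, h2, h3, h4, max_eq_left, max_eq_right, min_eq_left, min_eq_right] <;>
    first
    | (rw [max_eq_left (by linarith)]; linarith)
    | (rw [max_eq_right (by linarith)]; linarith)

section BrownianMotion

variable {Ω : Type*} [MeasurableSpace Ω] {P : Measure Ω} {T : ℝ}

lemma StepIntegrand.hasGaussianLaw_integral (g : StepIntegrand T) {W : ℝ≥0 → Ω → ℝ}
    (hW : IsPreBrownianReal W P) : HasGaussianLaw (g.integral W) P := by
  classical
  have h : IsGaussianProcess (fun (k : Fin g.card) ω => W (g.right k) ω - W (g.left k) ω) P :=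
    hW.isGaussianProcess.of_isGaussianProcess fun k => ⟨{g.right k, g.left k},
      { toFun x := x ⟨g.right k, by simp⟩ - x ⟨g.left k, by simp⟩
        map_add' x y := by simp; abel
        map_smul' c x := by simp; ring }, by simp⟩
  exact (h.smul g.coef).hasGaussianLaw_fun_sum (I := Finset.univ)

lemma StepIntegrand.integral_integral_eq_zero (g : StepIntegrand T) {W : ℝ≥0 → Ω → ℝ}
    (hW : IsPreBrownianReal W P) : P[g.integral W] = 0 := by
  unfold StepIntegrand.integral
  have hi := fun t => hW.integrable_eval t
  have hk (k) : Integrable (fun ω => g.coef k * (W (g.right k) ω - W (g.left k) ω)) P :=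
    ((hi _).sub (hi _)).const_mul _
  rw [integral_finsetSum _ fun k _ => hk k]
  refine Finset.sum_eq_zero fun k _ => ?_
  rw [integral_const_mul]
  have := integral_sub (hi (g.right k)) (hi (g.left k))
  simp only [hW.integral_eval, sub_self] at this
  rw [this, mul_zero]

/-- The Itô isometry for step integrands. -/
lemma StepIntegrand.variance_integral (g : StepIntegrand T) {W : ℝ≥0 → Ω → ℝ}
    (hW : IsPreBrownianReal W P) :
    Var[g.integral W; P] = ∫ s in Set.Ioc 0 T, g.toFun s ^ 2 := by
  have := hW.isGaussianProcess.isProbabilityMeasure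
  have hL (t) : MemLp (W t) 2 P := (hW.isGaussianProcess.hasGaussianLaw_eval t).memLp_two
  rw [← covariance_self (g.hasGaussianLaw_integral hW).aemeasurable]
  unfold StepIntegrand.integral
  have hk (k) : MemLp (fun ω => g.coef k * (W (g.right k) ω - W (g.left k) ω)) 2 P :=
    ((hL _).sub (hL _)).const_mul _
  rw [covariance_fun_sum_fun_sum hk hk]
  simp_rw [covariance_const_mul_left, covariance_const_mul_right]
  have hcov (k l) : cov[fun ω => W (g.right k) ω - W (g.left k) ω,
      fun ω => W (g.right l) ω - W (g.left l) ω; P]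
      = ∫ s in Set.Ioc 0 T, (Set.Ioc (g.left k : ℝ) (g.right k)).indicator (fun _ => (1 : ℝ)) s *
        (Set.Ioc (g.left l : ℝ) (g.right l)).indicator (fun _ => (1 : ℝ)) s := by
    rw [covariance_fun_sub_fun_sub (hL _) (hL _) (hL _) (hL _),
      setIntegral_indicator_mul_indicator (g.left_le_right k) (g.left_le_right l) (g.right_le k)]
    simp only [hW.covariance_eval]
  have hint (k l) : Integrable (fun s =>
      (Set.Ioc (g.left k : ℝ) (g.right k)).indicator (fun _ => (1 : ℝ)) s *
      (Set.Ioc (g.left l : ℝ) (g.right l)).indicator (fun _ => (1 : ℝ)) s)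
      (volume.restrict (Set.Ioc 0 T)) := by
    refine Integrable.of_bound (C := 1) ?_ (Eventually.of_forall fun s => ?_)
    · exact ((measurable_const.indicator measurableSet_Ioc).mul
        (measurable_const.indicator measurableSet_Ioc)).aestronglyMeasurable
    · by_cases h : s ∈ Set.Ioc (g.left k : ℝ) (g.right k) <;>
        by_cases h' : s ∈ Set.Ioc (g.left l : ℝ) (g.right l) <;> simp [h, h']
  simp_rw [hcov, ← integral_const_mul]
  unfold toFun
  simp_rw [sq, Finset.sum_mul_sum]
  have hint' (k l) : Integrable (fun s =>
      g.coef k * (Set.Ioc (g.left k : ℝ) (g.right k)).indicator (fun _ => (1 : ℝ)) s *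
      (g.coef l * (Set.Ioc (g.left l : ℝ) (g.right l)).indicator (fun _ => (1 : ℝ)) s))
      (volume.restrict (Set.Ioc 0 T)) := by
    refine (((hint k l).const_mul (g.coef l)).const_mul (g.coef k)).congr
      (Eventually.of_forall fun s => ?_)
    simp only; ring
  rw [integral_finsetSum _ fun k _ => integrable_finsetSum _ fun l _ => hint' k l]
  refine Finset.sum_congr rfl fun k _ => ?_
  rw [integral_finsetSum _ fun l _ => hint' k l]
  refine Finset.sum_congr rfl fun l _ => ?_
  congr 1; ext s; ring

/-- Characteristic function, at `1`, of the sum of an independent variable `U` and of the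
elementary integrals of step integrands against the components of a Brownian motion. -/
lemma integral_cexp_add_sum_stepIntegrand {d : ℕ} {B : Fin d → ℝ≥0 → Ω → ℝ}
    (hB : IsStdBrownianMotion B P) [IsProbabilityMeasure P] {U : Ω → ℝ} (hU : AEMeasurable U P)
    (hind : IndepFun U (fun (ω : Ω) (j : Fin d) (t : ℝ≥0) => B j t ω) P)
    (g : Fin d → StepIntegrand T) :
    ∫ ω, Complex.exp ((U ω + ∑ j, (g j).integral (B j) ω : ℝ) * Complex.I) ∂P
      = (∫ ω, Complex.exp (U ω * Complex.I) ∂P) *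
        Complex.exp ((-(∑ j, ∫ s in Set.Ioc 0 T, (g j).toFun s ^ 2) / 2 : ℝ)) := by
  have hG (j) := (g j).hasGaussianLaw_integral (hB.isBrownianReal j).toIsPreBrownianReal
  have hm (j) : AEMeasurable ((g j).integral (B j)) P := (hG j).aemeasurable
  have hindS : IndepFun U (fun ω => ∑ j, (g j).integral (B j) ω) P :=
    hind.comp (φ := id) (ψ := fun w : Fin d → ℝ≥0 → ℝ => ∑ j, ∑ k, (g j).coef k *
      (w j ((g j).right k) - w j ((g j).left k))) measurable_id
      (Finset.measurable_sum _ fun j _ => (g j).measurable_integral_eval.comp (measurable_pi_apply j))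
  have hindB : iIndepFun (fun j => (g j).integral (B j)) P :=
    hB.indep.comp (fun j w => ∑ k, (g j).coef k * (w ((g j).right k) - w ((g j).left k)))
      fun j => (g j).measurable_integral_eval
  have hchar (V : Ω → ℝ) (hV : AEMeasurable V P) :
      ∫ ω, Complex.exp (V ω * Complex.I) ∂P = charFun (P.map V) 1 := by
    rw [charFun_apply_real, integral_map hV (by fun_prop)]
    simp
  have hS : AEMeasurable (fun ω => ∑ j, (g j).integral (B j) ω) P :=
    Finset.aemeasurable_fun_sum _ fun j _ => hm j
  rw [hchar (fun ω => U ω + ∑ j, (g j).integral (B j) ω) (hU.add hS), hchar U hU,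
    hindS.charFun_map_fun_add_eq_mul hU hS,
    Pi.mul_apply, hindB.charFun_map_fun_sum_eq_prod hm, Finset.prod_apply]
  congr 1
  rw [← Finset.sum_neg_distrib, Finset.sum_div, Complex.ofReal_sum, Complex.exp_sum]
  refine Finset.prod_congr rfl fun j _ => ?_
  rw [(hG j).charFun_map_eq]
  have h0 := (g j).integral_integral_eq_zero (hB.isBrownianReal j).toIsPreBrownianReal
  have hv := (g j).variance_integral (hB.isBrownianReal j).toIsPreBrownianReal
  have hi : (fun ω => inner ℝ (1 : ℝ) ((g j).integral (B j) ω)) = (g j).integral (B j) := by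
    ext ω; simp
  rw [hi, h0, hv]
  push_cast
  congr 1
  simp; ring

end BrownianMotion

lemma tendsto_integral_cexp {Ω : Type*} [MeasurableSpace Ω] {P : Measure Ω} [IsFiniteMeasure P]
    {F : ℕ → Ω → ℝ} {G : Ω → ℝ} (hF : ∀ n, AEMeasurable (F n) P)
    (h : ∀ᵐ ω ∂P, Tendsto (fun n => F n ω) atTop (𝓝 (G ω))) :
    Tendsto (fun n => ∫ ω, Complex.exp (F n ω * Complex.I) ∂P) atTop
      (𝓝 (∫ ω, Complex.exp (G ω * Complex.I) ∂P)) := by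
  refine tendsto_integral_of_dominated_convergence (fun _ => 1) (fun n => ?_)
    (integrable_const _) (fun n => Eventually.of_forall fun ω => ?_) ?_
  · have := hF n
    exact AEMeasurable.aestronglyMeasurable (by fun_prop)
  · rw [Complex.norm_exp_ofReal_mul_I]
  · filter_upwards [h] with ω hω
    exact (Complex.continuous_exp.comp (by fun_prop :
      Continuous fun x : ℝ => (x : ℂ) * Complex.I)).continuousAt.tendsto.comp hω

lemma tendsto_integral_sq_of_tendsto_eLpNorm {α : Type*} [MeasurableSpace α] {μ : Measure α}
    {f : ℕ → α → ℝ} {h : α → ℝ} (hf : ∀ n, MemLp (f n) 2 μ) (hh : MemLp h 2 μ)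
    (hlim : Tendsto (fun n => eLpNorm (f n - h) 2 μ) atTop (𝓝 0)) :
    Tendsto (fun n => ∫ x, f n x ^ 2 ∂μ) atTop (𝓝 (∫ x, h x ^ 2 ∂μ)) := by
  have key {u : α → ℝ} (hu : MemLp u 2 μ) : ∫ x, u x ^ 2 ∂μ = ‖hu.toLp u‖ ^ 2 := by
    rw [← real_inner_self_eq_norm_sq, L2.inner_def]
    refine integral_congr_ae ?_
    filter_upwards [hu.coeFn_toLp] with x hx
    simp [hx, sq]
  simp_rw [fun n => key (hf n), key hh]
  exact (((Lp.tendsto_Lp_iff_tendsto_eLpNorm'' f hf h hh).2 hlim).norm).pow 2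

/-- Characteristic function, at `1`, of the sum of an independent variable `U` and of the
Itô integrals of deterministic functions `h j` against the components of a Brownian motion:
the Itô integrals contribute a centered Gaussian factor with variance `∑ j, ∫ h j ^ 2`. -/
lemma integral_cexp_add_sum_ito {Ω : Type*} [MeasurableSpace Ω] {P : Measure Ω}
    [IsProbabilityMeasure P] {T : ℝ} {d : ℕ} {B : Fin d → ℝ≥0 → Ω → ℝ}
    (hB : IsStdBrownianMotion B P) {U : Ω → ℝ} (hU : AEMeasurable U P)
    (hind : IndepFun U (fun (ω : Ω) (j : Fin d) (t : ℝ≥0) => B j t ω) P)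
    {h : Fin d → ℝ → ℝ} (hh : ∀ j, MemLp (h j) 2 (volume.restrict (Set.Ioc 0 T)))
    {N : Fin d → Ω → ℝ} (hN : ∀ j, IsItoIntegral P (B j) (h j) T (N j)) :
    ∫ ω, Complex.exp ((U ω + ∑ j, N j ω : ℝ) * Complex.I) ∂P
      = (∫ ω, Complex.exp (U ω * Complex.I) ∂P) *
        Complex.exp ((-(∑ j, ∫ s in Set.Ioc 0 T, h j s ^ 2) / 2 : ℝ)) := by
  have hε (n : ℕ) : (0 : ℝ≥0∞) < ((n : ℝ≥0∞) + 1)⁻¹ := by simp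
  have hε0 : Tendsto (fun n : ℕ => ((n : ℝ≥0∞) + 1)⁻¹) atTop (𝓝 0) := by
    have := (tendsto_add_atTop_iff_nat 1).2 ENNReal.tendsto_inv_nat_nhds_zero
    simpa using this
  choose g hg1 hg2 using fun (n : ℕ) (j : Fin d) => (hN j).2 _ (hε n)
  have hG (n j) := (g n j).hasGaussianLaw_integral (hB.isBrownianReal j).toIsPreBrownianReal
  have hm (n j) : AEMeasurable ((g n j).integral (B j)) P := (hG n j).aemeasurable
  have hNm (j) : AEMeasurable (N j) P := (hN j).1.aestronglyMeasurable.aemeasurable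
  have hL2 : Tendsto (fun n => eLpNorm ((fun ω => ∑ j, (g n j).integral (B j) ω)
      - fun ω => ∑ j, N j ω) 2 P) atTop (𝓝 0) := by
    refine tendsto_of_tendsto_of_tendsto_of_le_of_le tendsto_const_nhds
      (h := fun n : ℕ => ∑ j : Fin d, ((n : ℝ≥0∞) + 1)⁻¹) ?_ (fun _ => zero_le) fun n => ?_
    · simpa using tendsto_finsetSum (Finset.univ : Finset (Fin d)) fun j _ => hε0
    · have he : ((fun ω => ∑ j, (g n j).integral (B j) ω) - fun ω => ∑ j, N j ω)
          = ∑ j, ((g n j).integral (B j) - N j) := by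
        ext ω; simp [Finset.sum_sub_distrib]
      rw [he]
      refine (eLpNorm_sum_le (fun j _ => ((hm n j).sub (hNm j)).aestronglyMeasurable)
        (by norm_num)).trans (Finset.sum_le_sum fun j _ => ?_)
      rw [eLpNorm_sub_comm]
      exact hg2 n j
  have hSm (n) : AEMeasurable (fun ω => ∑ j, (g n j).integral (B j) ω) P :=
    Finset.aemeasurable_fun_sum _ fun j _ => hm n j
  have hSNm : AEMeasurable (fun ω => ∑ j, N j ω) P :=
    Finset.aemeasurable_fun_sum _ fun j _ => hNm j
  -- along a subsequence the elementary integrals converge almost surely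
  obtain ⟨ns, hns, hae⟩ := (tendstoInMeasure_of_tendsto_eLpNorm (two_ne_zero)
    (fun n => (hSm n).aestronglyMeasurable) hSNm.aestronglyMeasurable hL2).exists_seq_tendsto_ae
  have hlim1 := tendsto_integral_cexp (P := P)
    (F := fun n ω => U ω + ∑ j, (g (ns n) j).integral (B j) ω) (G := fun ω => U ω + ∑ j, N j ω)
    (fun n => hU.add (hSm _)) (by
      filter_upwards [hae] with ω hω
      exact tendsto_const_nhds.add hω)
  have hvar (j) : Tendsto (fun n => ∫ s in Set.Ioc 0 T, (g (ns n) j).toFun s ^ 2) atTop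
      (𝓝 (∫ s in Set.Ioc 0 T, h j s ^ 2)) := by
    suffices h0 : Tendsto (fun n => eLpNorm ((g n j).toFun - h j) 2
        (volume.restrict (Set.Ioc 0 T))) atTop (𝓝 0) from
      (tendsto_integral_sq_of_tendsto_eLpNorm (fun n => (g n j).memLp_toFun 2 _) (hh j)
        h0).comp hns.tendsto_atTop
    refine tendsto_of_tendsto_of_tendsto_of_le_of_le tendsto_const_nhds hε0
      (fun _ => zero_le) fun n => ?_
    rw [eLpNorm_sub_comm]
    exact hg1 n j
  have hlim2 : Tendsto (fun n => (∫ ω, Complex.exp (U ω * Complex.I) ∂P) *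
        Complex.exp ((-(∑ j, ∫ s in Set.Ioc 0 T, (g (ns n) j).toFun s ^ 2) / 2 : ℝ))) atTop
      (𝓝 ((∫ ω, Complex.exp (U ω * Complex.I) ∂P) *
        Complex.exp ((-(∑ j, ∫ s in Set.Ioc 0 T, h j s ^ 2) / 2 : ℝ)))) := by
    refine tendsto_const_nhds.mul ((Complex.continuous_exp.comp
      Complex.continuous_ofReal).continuousAt.tendsto.comp ?_)
    exact ((tendsto_finsetSum _ fun j _ => hvar j).neg).div_const 2
  refine tendsto_nhds_unique hlim1 (hlim2.congr fun n => ?_)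
  exact (integral_cexp_add_sum_stepIntegrand hB hU hind _).symm

/-! ### Linearity of the stochastic integral -/

section Linear

variable {Ω : Type*} [MeasurableSpace Ω] {P : Measure Ω} {W : ℝ≥0 → Ω → ℝ} {T : ℝ}

/-- The integral over `(0, t]` is the integral over `(0, T]` of the integrand cut off at `t`: the
step integrands that approximate it already vanish after time `t`. -/
lemma IsItoIntegral.extend {t : ℝ} (htT : t ≤ T) {f : ℝ → ℝ} {I : Ω → ℝ}
    (h : IsItoIntegral P W f t I) : IsItoIntegral P W ((Set.Ioc 0 t).indicator f) T I := by
  refine ⟨h.1, fun ε hε => ?_⟩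
  obtain ⟨g, hg1, hg2⟩ := h.2 ε hε
  refine ⟨⟨g.card, g.coef, g.left, g.right, g.left_le_right,
    fun k => (g.right_le k).trans htT⟩, ?_, hg2⟩
  have he : (fun s => (Set.Ioc 0 t).indicator f s - g.toFun s)
      = (Set.Ioc 0 t).indicator (fun s => f s - g.toFun s) := by
    ext s
    by_cases hs : s ∈ Set.Ioc 0 t
    · simp [hs]
    · have : g.toFun s = 0 := by
        unfold StepIntegrand.toFun
        refine Finset.sum_eq_zero fun k _ => ?_
        rw [Set.indicator_of_notMem, mul_zero]
        exact fun h => hs ⟨lt_of_le_of_lt (NNReal.coe_nonneg _) h.1, h.2.trans (g.right_le k)⟩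
      simp [hs, this]
  change eLpNorm (fun s => (Set.Ioc 0 t).indicator f s - g.toFun s) 2 _ ≤ ε
  rw [he, eLpNorm_indicator_eq_eLpNorm_restrict measurableSet_Ioc,
    Measure.restrict_restrict measurableSet_Ioc,
    Set.inter_eq_left.2 (Set.Ioc_subset_Ioc_right htT)]
  exact hg1

lemma IsItoIntegral.zero : IsItoIntegral P W (fun _ => 0) T (fun _ => 0) := by
  refine ⟨MemLp.zero, fun ε hε => ⟨⟨0, Fin.elim0, Fin.elim0, Fin.elim0, fun k => k.elim0,
    fun k => k.elim0⟩, ?_, ?_⟩⟩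
  · simp [StepIntegrand.toFun]
  · simp [StepIntegrand.integral]

lemma IsItoIntegral.const_mul {f : ℝ → ℝ} {I : Ω → ℝ}
    (h : IsItoIntegral P W f T I) (c : ℝ) :
    IsItoIntegral P W (fun s => c * f s) T (fun ω => c * I ω) := by
  refine ⟨h.1.const_mul c, fun ε hε => ?_⟩
  obtain ⟨g, hg1, hg2⟩ := h.2 (ε / (‖c‖ₑ + 1)) (ENNReal.div_pos hε.ne' (by simp))
  -- the `+ 1` in the denominator covers `c = 0`
  have hle : ‖c‖ₑ * (ε / (‖c‖ₑ + 1)) ≤ ε := by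
    rw [← mul_div_assoc, mul_comm]
    refine ENNReal.div_le_of_le_mul ?_
    gcongr
    exact le_self_add
  refine ⟨⟨g.card, fun k => c * g.coef k, g.left, g.right, g.left_le_right, g.right_le⟩, ?_, ?_⟩
  · have : (fun s => c * f s - StepIntegrand.toFun ⟨g.card, fun k => c * g.coef k, g.left,
        g.right, g.left_le_right, g.right_le⟩ s) = c • fun s => f s - g.toFun s := by
      ext s; simp [StepIntegrand.toFun, mul_sub, Finset.mul_sum, mul_assoc]
    rw [this, eLpNorm_const_smul]
    exact (mul_le_mul_right hg1 _).trans hle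
  · have : (fun ω => c * I ω - StepIntegrand.integral (t := T) ⟨g.card, fun k => c * g.coef k,
        g.left, g.right, g.left_le_right, g.right_le⟩ W ω)
        = c • fun ω => I ω - g.integral W ω := by
      ext s; simp [StepIntegrand.integral, mul_sub, Finset.mul_sum, mul_assoc]
    rw [this, eLpNorm_const_smul]
    exact (mul_le_mul_right hg2 _).trans hle

lemma IsItoIntegral.add (hW : IsPreBrownianReal W P) {f f' : ℝ → ℝ} {I I' : Ω → ℝ}
    (hf : AEStronglyMeasurable f (volume.restrict (Set.Ioc 0 T)))
    (hf' : AEStronglyMeasurable f' (volume.restrict (Set.Ioc 0 T)))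
    (h : IsItoIntegral P W f T I) (h' : IsItoIntegral P W f' T I') :
    IsItoIntegral P W (fun s => f s + f' s) T (fun ω => I ω + I' ω) := by
  refine ⟨h.1.add h'.1, fun ε hε => ?_⟩
  obtain ⟨g, hg1, hg2⟩ := h.2 (ε / 2) (ENNReal.half_pos hε.ne')
  obtain ⟨g', hg1', hg2'⟩ := h'.2 (ε / 2) (ENNReal.half_pos hε.ne')
  let G : StepIntegrand T :=
    ⟨g.card + g'.card, Fin.append g.coef g'.coef, Fin.append g.left g'.left,
      Fin.append g.right g'.right,
      fun k => by
        induction k using Fin.addCases with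
        | left k => simpa using g.left_le_right k
        | right k => simpa using g'.left_le_right k,
      fun k => by
        induction k using Fin.addCases with
        | left k => simpa using g.right_le k
        | right k => simpa using g'.right_le k⟩
  refine ⟨G, ?_, ?_⟩
  · have : (fun s => f s + f' s - G.toFun s)
        = (fun s => f s - g.toFun s) + fun s => f' s - g'.toFun s := by
      ext s
      simp only [StepIntegrand.toFun, G, Fin.sum_univ_add, Fin.append_left, Fin.append_right,
        Pi.add_apply]
      ring
    rw [this]
    refine (eLpNorm_add_le (hf.sub g.measurable_toFun.aestronglyMeasurable)
      (hf'.sub g'.measurable_toFun.aestronglyMeasurable) (by norm_num)).trans ?_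
    exact (add_le_add hg1 hg1').trans (ENNReal.add_halves ε).le
  · have : (fun ω => I ω + I' ω - G.integral W ω)
        = (fun ω => I ω - g.integral W ω) + fun ω => I' ω - g'.integral W ω := by
      ext s
      simp only [StepIntegrand.integral, G, Fin.sum_univ_add, Fin.append_left, Fin.append_right,
        Pi.add_apply]
      ring
    rw [this]
    refine (eLpNorm_add_le
      (h.1.aestronglyMeasurable.sub (g.hasGaussianLaw_integral hW).aemeasurable.aestronglyMeasurable)
      (h'.1.aestronglyMeasurable.sub
        (g'.hasGaussianLaw_integral hW).aemeasurable.aestronglyMeasurable) (by norm_num)).trans ?_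
    exact (add_le_add hg2 hg2').trans (ENNReal.add_halves ε).le

lemma IsItoIntegral.sum (hW : IsPreBrownianReal W P) {ι : Type*} (s : Finset ι)
    {f : ι → ℝ → ℝ} {I : ι → Ω → ℝ}
    (hf : ∀ i ∈ s, AEStronglyMeasurable (f i) (volume.restrict (Set.Ioc 0 T)))
    (h : ∀ i ∈ s, IsItoIntegral P W (f i) T (I i)) :
    IsItoIntegral P W (fun r => ∑ i ∈ s, f i r) T (fun ω => ∑ i ∈ s, I i ω) := by
  classical
  induction s using Finset.induction_on with
  | empty => simpa using IsItoIntegral.zero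
  | insert a s ha ih =>
    simp only [Finset.sum_insert ha]
    refine IsItoIntegral.add hW (hf a (by simp)) ?_ (h a (by simp))
      (ih (fun i hi => hf i (by simp [hi])) fun i hi => h i (by simp [hi]))
    exact Finset.aestronglyMeasurable_fun_sum _ fun i hi => hf i (by simp [hi])

end Linear

/-! ### The first variation process and variation of constants -/

section FirstVariation

-- Any matrix norm would do: it only serves to speak of derivatives of matrix-valued functions.
attribute [local instance] Matrix.linftyOpNormedAddCommGroup Matrix.linftyOpNormedSpace
  Matrix.linftyOpNormedRing Matrix.linftyOpNormedAlgebra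

variable {m : ℕ} {T : ℝ} {b Y : ℝ → Matrix (Fin m) (Fin m) ℝ}

lemma continuous_toEuclideanCLM :
    Continuous (toEuclideanCLM (n := Fin m) (𝕜 := ℝ)) :=
  (toEuclideanCLM (n := Fin m) (𝕜 := ℝ)).toAlgEquiv.toLinearMap.continuous_of_finiteDimensional

lemma hasDerivWithinAt_toEuclideanCLM {A : ℝ → Matrix (Fin m) (Fin m) ℝ}
    {A' : Matrix (Fin m) (Fin m) ℝ} {s : Set ℝ} {t : ℝ} (hA : HasDerivWithinAt A A' s t) :
    HasDerivWithinAt (fun t => toEuclideanCLM (n := Fin m) (𝕜 := ℝ) (A t))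
      (toEuclideanCLM (n := Fin m) (𝕜 := ℝ) A') s t :=
  (LinearMap.toContinuousLinearMap (toEuclideanCLM (n := Fin m)
    (𝕜 := ℝ)).toAlgEquiv.toLinearMap).hasFDerivAt.comp_hasDerivWithinAt t hA

lemma toEuclideanCLM_apply_eq (A : Matrix (Fin m) (Fin m) ℝ) (x : EuclideanSpace ℝ (Fin m)) :
    toEuclideanCLM (n := Fin m) (𝕜 := ℝ) A x = toEuclideanLin A x := rfl

lemma IsFirstVariation.hasDerivWithinAt (hY : IsFirstVariation b T Y) {t : ℝ}
    (ht : t ∈ Set.Icc 0 T) : HasDerivWithinAt Y (b t * Y t) (Set.Icc 0 T) t := by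
  have h := fun i => hasDerivWithinAt_pi.2 fun j => hY.deriv t ht i j
  exact hasDerivWithinAt_pi.2 h

lemma continuousOn_toEuclideanCLM {A : ℝ → Matrix (Fin m) (Fin m) ℝ} {s : Set ℝ}
    (hA : ContinuousOn A s) :
    ContinuousOn (fun t => toEuclideanCLM (n := Fin m) (𝕜 := ℝ) (A t)) s :=
  continuous_toEuclideanCLM.comp_continuousOn hA

/-- The fundamental matrix of a linear equation is invertible: a vector of its kernel at time `t`
spans a solution vanishing at time `t`, hence at time `0` by backward uniqueness. -/
lemma IsFirstVariation.isUnit (hY : IsFirstVariation b T Y) (hb : ContinuousOn b (Set.Icc 0 T))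
    {t : ℝ} (ht : t ∈ Set.Icc 0 T) : IsUnit (Y t) := by
  rw [← mulVec_injective_iff_isUnit]
  refine (injective_iff_map_eq_zero (mulVecLin (Y t))).2 fun v hv => ?_
  have hb' := continuousOn_toEuclideanCLM hb
  obtain ⟨K, hK⟩ := isCompact_Icc.exists_bound_of_continuousOn hb'
  have hK' : ∀ s ∈ Set.Icc 0 T, ‖toEuclideanCLM (n := Fin m) (𝕜 := ℝ) (b s)‖₊ ≤ K.toNNReal :=
    fun s hs => by
      rw [← NNReal.coe_le_coe, coe_nnnorm]
      exact (hK s hs).trans (Real.le_coe_toNNReal K)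
  let w : EuclideanSpace ℝ (Fin m) := WithLp.toLp 2 v
  have hY' (s) (hs : s ∈ Set.Icc 0 T) : HasDerivWithinAt
      (fun s => toEuclideanCLM (n := Fin m) (𝕜 := ℝ) (Y s) w)
      (toEuclideanCLM (n := Fin m) (𝕜 := ℝ) (b s)
        (toEuclideanCLM (n := Fin m) (𝕜 := ℝ) (Y s) w)) (Set.Icc 0 T) s := by
    have h1 := hasDerivWithinAt_toEuclideanCLM (hY.hasDerivWithinAt hs)
    have h2 := h1.clm_apply (hasDerivWithinAt_const s (Set.Icc 0 T) w)
    refine h2.congr_deriv ?_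
    rw [map_mul, map_zero, add_zero]
    rfl
  have huniq := ODE_solution_unique_of_mem_Icc_left (a := 0) (b := t) (K := K.toNNReal)
    (v := fun s x => toEuclideanCLM (n := Fin m) (𝕜 := ℝ) (b s) x) (s := fun _ => Set.univ)
    (f := fun s => toEuclideanCLM (n := Fin m) (𝕜 := ℝ) (Y s) w) (g := fun _ => 0)
    (fun s hs => ((ContinuousLinearMap.lipschitz _).weaken
      (hK' s ⟨hs.1.le, hs.2.trans ht.2⟩)).lipschitzOnWith)
    (fun s hs => ((hY' s ⟨hs.1, hs.2.trans ht.2⟩).continuousWithinAt).mono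
      (Set.Icc_subset_Icc_right ht.2))
    (fun s hs => (hY' s ⟨hs.1.le, hs.2.trans ht.2⟩).mono_of_mem_nhdsWithin
      (Icc_mem_nhdsLE_of_mem ⟨hs.1, hs.2.trans ht.2⟩))
    (fun _ _ => Set.mem_univ _) continuousOn_const
    (fun s _ => by simpa using hasDerivWithinAt_const s (Set.Iic s) (0 : EuclideanSpace ℝ (Fin m)))
    (fun _ _ => Set.mem_univ _) (by
      change toEuclideanLin (Y t) w = 0
      rw [toLpLin_apply]
      simpa [w] using hv)
  have h0 := huniq (Set.left_mem_Icc.2 ht.1)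
  simp only [hY.zero, map_one, one_apply_eq_self] at h0
  simpa [w] using h0

lemma IsFirstVariation.hasDerivWithinAt_inv (hY : IsFirstVariation b T Y)
    (hb : ContinuousOn b (Set.Icc 0 T)) {t : ℝ} (ht : t ∈ Set.Icc 0 T) :
    HasDerivWithinAt (fun s => (Y s)⁻¹) (-((Y t)⁻¹ * b t)) (Set.Icc 0 T) t := by
  obtain ⟨u, hu⟩ := hY.isUnit hb ht
  have h := hasFDerivAt_ringInverse (𝕜 := ℝ) u
  rw [hu] at h
  have h1 := h.comp_hasDerivWithinAt t (hY.hasDerivWithinAt ht)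
  have e : (Ring.inverse ∘ Y) = fun s => (Y s)⁻¹ := by
    ext s : 1; simp [nonsing_inv_eq_ringInverse]
  rw [e] at h1
  refine h1.congr_deriv ?_
  have hu' : (↑u⁻¹ : Matrix (Fin m) (Fin m) ℝ) = (Y t)⁻¹ := by
    rw [← hu, coe_units_inv]
  have hdet : IsUnit (Y t).det := (isUnit_iff_isUnit_det _).1 (hY.isUnit hb ht)
  simp [hu', mul_assoc, mul_nonsing_inv _ hdet]

lemma IsFirstVariation.continuousOn_inv (hY : IsFirstVariation b T Y)
    (hb : ContinuousOn b (Set.Icc 0 T)) : ContinuousOn (fun s => (Y s)⁻¹) (Set.Icc 0 T) :=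
  fun _ ht => (hY.hasDerivWithinAt_inv hb ht).continuousWithinAt

lemma IsFirstVariation.continuousOn_resolvent (hY : IsFirstVariation b T Y)
    (hb : ContinuousOn b (Set.Icc 0 T)) :
    ContinuousOn (fun s => Y T * (Y s)⁻¹ * b s) (Set.Icc 0 T) :=
  (continuousOn_const.mul (hY.continuousOn_inv hb)).mul hb

/-- The identity `∫_r^T Y_T Y_s⁻¹ b(s) ds = Y_T Y_r⁻¹ - 1`, entrywise. -/
lemma IsFirstVariation.integral_resolvent (hY : IsFirstVariation b T Y)
    (hb : ContinuousOn b (Set.Icc 0 T)) {r : ℝ} (hr : r ∈ Set.Icc 0 T) (i j : Fin m) :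
    ∫ s in r..T, (Y T * (Y s)⁻¹ * b s) i j = (Y T * (Y r)⁻¹ - 1) i j := by
  have hsub : Set.Icc r T ⊆ Set.Icc 0 T := Set.Icc_subset_Icc_left hr.1
  have hdet : IsUnit (Y T).det :=
    (isUnit_iff_isUnit_det _).1 (hY.isUnit hb ⟨hr.1.trans hr.2, le_rfl⟩)
  have hd (s) (hs : s ∈ Set.Icc 0 T) : HasDerivWithinAt (fun s => -(Y T * (Y s)⁻¹) i j)
      ((Y T * (Y s)⁻¹ * b s) i j) (Set.Icc 0 T) s := by
    have h1 : HasDerivWithinAt (fun s => -(Y T * (Y s)⁻¹))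
        (-(Y T * -((Y s)⁻¹ * b s))) (Set.Icc 0 T) s :=
      ((hY.hasDerivWithinAt_inv hb hs).const_mul (Y T)).neg
    have h2 := hasDerivWithinAt_pi.1 (hasDerivWithinAt_pi.1 h1 i) j
    refine h2.congr_deriv ?_
    simp [mul_assoc]
  have hc : ContinuousOn (fun s => (Y T * (Y s)⁻¹ * b s) i j) (Set.Icc r T) :=
    ((continuous_apply_apply i j).comp_continuousOn (hY.continuousOn_resolvent hb)).mono hsub
  rw [intervalIntegral.integral_eq_sub_of_hasDerivAt_of_le hr.2
    (f := fun s => -(Y T * (Y s)⁻¹) i j)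
    (fun s hs => ((hd s (hsub hs)).continuousWithinAt).mono hsub)
    (fun s hs => (hd s (hsub ⟨hs.1.le, hs.2.le⟩)).hasDerivAt
      (Icc_mem_nhds (hr.1.trans_lt hs.1) hs.2))
    (hc.intervalIntegrable_of_Icc hr.2)]
  simp [mul_nonsing_inv _ hdet]
  ring

/-- Variation of constants for a path `x` of `dx = b x dt + dN`, where the driving path is
`N t = x t - x 0 - ∫_0^t b x`. The integral `∫_0^T Y_T Y_s⁻¹ dN_s` is written in its integrated by
parts form, which makes sense for a merely continuous `N`. -/
lemma IsFirstVariation.eq_of_path (hT : 0 ≤ T) (hY : IsFirstVariation b T Y)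
    (hb : ContinuousOn b (Set.Icc 0 T)) {x : ℝ → EuclideanSpace ℝ (Fin m)}
    (hx : ContinuousOn x (Set.Icc 0 T)) {N : ℝ → EuclideanSpace ℝ (Fin m)}
    (hN : ∀ t ∈ Set.Icc 0 T, N t = x t - x 0 - ∫ s in (0 : ℝ)..t, toEuclideanLin (b s) (x s)) :
    ContinuousOn N (Set.Icc 0 T) ∧
    x T = toEuclideanLin (Y T) (x 0) + (N T +
      ∫ s in (0 : ℝ)..T, toEuclideanLin (Y T * (Y s)⁻¹ * b s) (N s)) := by
  let c : Matrix (Fin m) (Fin m) ℝ → _ := toEuclideanCLM (n := Fin m) (𝕜 := ℝ)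
  have hdet : IsUnit (Y T).det := (isUnit_iff_isUnit_det _).1 (hY.isUnit hb ⟨hT, le_rfl⟩)
  have hbx : ContinuousOn (fun s => toEuclideanLin (b s) (x s)) (Set.Icc 0 T) :=
    (continuousOn_toEuclideanCLM hb).clm_apply hx
  set A : ℝ → EuclideanSpace ℝ (Fin m) :=
    fun t => ∫ s in (0 : ℝ)..t, toEuclideanLin (b s) (x s) with hA
  have hAc : ContinuousOn A (Set.Icc 0 T) := by
    have := intervalIntegral.continuousOn_primitive_interval
      (f := fun s => toEuclideanLin (b s) (x s)) (μ := volume) (a := 0) (b := T) (by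
      rw [Set.uIcc_of_le hT]; exact hbx.integrableOn_Icc)
    rwa [Set.uIcc_of_le hT] at this
  have hNc : ContinuousOn N (Set.Icc 0 T) :=
    ((hx.sub continuousOn_const).sub hAc).congr hN
  refine ⟨hNc, ?_⟩
  have hAd (t) (ht : t ∈ Set.Ioo 0 T) : HasDerivAt A (toEuclideanLin (b t) (x t)) t := by
    refine intervalIntegral.integral_hasDerivAt_right
      ((hbx.mono (Set.Icc_subset_Icc_right ht.2.le)).intervalIntegrable_of_Icc ht.1.le)
      ?_ (hbx.continuousAt (Icc_mem_nhds ht.1 ht.2))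
    exact ContinuousOn.stronglyMeasurableAtFilter isOpen_Ioo
      (hbx.mono Set.Ioo_subset_Icc_self) t ht
  have hint : ContinuousOn (fun s => c ((Y s)⁻¹ * b s) (N s)) (Set.Icc 0 T) :=
    (continuousOn_toEuclideanCLM ((hY.continuousOn_inv hb).mul hb)).clm_apply hNc
  -- differentiate `s ↦ Y_s⁻¹ (x 0 + ∫_0^s b x)`
  have hftc := intervalIntegral.integral_eq_sub_of_hasDerivAt_of_le hT
    (f := fun s => c ((Y s)⁻¹) (x 0 + A s)) (f' := fun s => c ((Y s)⁻¹ * b s) (N s))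
    ((continuousOn_toEuclideanCLM (hY.continuousOn_inv hb)).clm_apply
      (continuousOn_const.add hAc))
    (fun t ht => by
      have ht' : t ∈ Set.Icc 0 T := ⟨ht.1.le, ht.2.le⟩
      have h1 := (hasDerivWithinAt_toEuclideanCLM (hY.hasDerivWithinAt_inv hb ht')).hasDerivAt
        (Icc_mem_nhds ht.1 ht.2)
      have h2 := h1.clm_apply ((hAd t ht).const_add (x 0))
      refine h2.congr_deriv ?_
      rw [map_neg, hN t ht', ← toEuclideanCLM_apply_eq]
      simp only [c, map_mul, map_sub, map_add,
        mul_apply_eq_comp, _root_.neg_apply, hA]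
      abel)
    (hint.intervalIntegrable_of_Icc hT)
  have hA0 : A 0 = 0 := by simp [hA]
  simp only [hA0, hY.zero, add_zero, inv_one] at hftc
  have h1 : c 1 (x 0) = x 0 := by simp [c]
  rw [h1] at hftc
  have h2 : ∫ s in (0 : ℝ)..T, toEuclideanLin (Y T * (Y s)⁻¹ * b s) (N s)
      = c (Y T) (∫ s in (0 : ℝ)..T, c ((Y s)⁻¹ * b s) (N s)) := by
    rw [← ContinuousLinearMap.intervalIntegral_comp_comm _ (hint.intervalIntegrable_of_Icc hT)]
    refine intervalIntegral.integral_congr fun s _ => ?_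
    rw [← toEuclideanCLM_apply_eq, mul_assoc, map_mul]
    rfl
  have h3 (z : EuclideanSpace ℝ (Fin m)) : c (Y T) (c ((Y T)⁻¹) z) = z := by
    have : c (Y T) (c ((Y T)⁻¹) z) = c (Y T * (Y T)⁻¹) z := by
      simp only [c, map_mul]; rfl
    rw [this, mul_nonsing_inv _ hdet]
    simp [c]
  rw [h2, hftc, map_sub, h3, hN T ⟨hT, le_rfl⟩, ← toEuclideanCLM_apply_eq]
  abel

end FirstVariation

/-! ### Riemann sums and pathwise integrals of Gaussian processes -/

/-- A Riemann sum at right endpoints is the integral of the function sampled at the next point of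
the grid. -/
lemma integral_comp_ceil {δ : ℝ} (hδ : 0 < δ) (F : ℝ → ℝ) (n : ℕ) :
    ∫ s in (0 : ℝ)..(δ * n), F (δ * ⌈s / δ⌉) = ∑ k ∈ Finset.range n, δ * F (δ * (k + 1)) := by
  have hk (k : ℕ) : Set.EqOn (fun s => F (δ * ⌈s / δ⌉)) (fun _ => F (δ * (k + 1)))
      (Set.uIoc (δ * k) (δ * (k + 1 : ℕ))) := by
    intro s hs
    have hle : δ * (k : ℝ) ≤ δ * ((k + 1 : ℕ) : ℝ) := by push_cast; nlinarith
    rw [Set.uIoc_of_le hle] at hs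
    have : ⌈s / δ⌉ = (k : ℤ) + 1 := by
      rw [Int.ceil_eq_iff]
      have h1 := hs.1
      have h2 := hs.2
      push_cast at h2 ⊢
      constructor
      · rw [add_sub_cancel_right, lt_div_iff₀ hδ]; linarith
      · rw [div_le_iff₀ hδ]; linarith
    simp [this]
  have hsum := intervalIntegral.sum_integral_adjacent_intervals (μ := volume) (n := n)
    (f := fun s => F (δ * ⌈s / δ⌉)) (a := fun k => δ * (k : ℝ))
    (fun k _ => (intervalIntegrable_const (c := F (δ * (k + 1)))).congr (hk k).symm)
  simp only [Nat.cast_zero, mul_zero] at hsum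
  rw [← hsum]
  refine Finset.sum_congr rfl fun k _ => ?_
  rw [intervalIntegral.integral_congr_ae (Eventually.of_forall (hk k)), intervalIntegral.integral_const]
  push_cast
  rw [smul_eq_mul]; ring

/-- Riemann sums at right endpoints converge for bounded functions which are continuous from the
right. The sampling point of `s` approaches `s` from the right, so that the jump of an indicator
function `1_{[r, ∞)}` is harmless. -/
lemma tendsto_riemann_sum {T C : ℝ} (hT : 0 < T) {F : ℝ → ℝ}
    (hb : ∀ s ∈ Set.Ioc 0 T, |F s| ≤ C)
    (hc : ∀ s ∈ Set.Ioc 0 T, ContinuousWithinAt F (Set.Icc s T) s) :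
    Tendsto (fun n : ℕ => ∑ k ∈ Finset.range (n + 1),
      T / (n + 1 : ℕ) * F (T / (n + 1 : ℕ) * (k + 1))) atTop (𝓝 (∫ s in Set.Ioc 0 T, F s)) := by
  have hδ (n : ℕ) : 0 < T / (n + 1 : ℕ) := by positivity
  have hδT (n : ℕ) : T / (n + 1 : ℕ) * (n + 1 : ℕ) = T := by field_simp
  have hδ0 : Tendsto (fun n : ℕ => T / (n + 1 : ℕ)) atTop (𝓝 0) :=
    (tendsto_add_atTop_iff_nat 1).2 (tendsto_const_div_atTop_nhds_zero_nat T)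
  -- the sampling point of `s` lies between `s` and `T`, within one step of `s`
  have hρ (n : ℕ) (s : ℝ) : s ≤ T / (n + 1 : ℕ) * ⌈s / (T / (n + 1 : ℕ))⌉ := by
    have := Int.le_ceil (s / (T / (n + 1 : ℕ)))
    rwa [div_le_iff₀' (hδ n)] at this
  have hρ' (n : ℕ) (s : ℝ) :
      T / (n + 1 : ℕ) * ⌈s / (T / (n + 1 : ℕ))⌉ ≤ s + T / (n + 1 : ℕ) := by
    have h1 := (Int.ceil_lt_add_one (s / (T / (n + 1 : ℕ)))).le
    calc _ ≤ T / (n + 1 : ℕ) * (s / (T / (n + 1 : ℕ)) + 1) := by gcongr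
      _ = _ := by rw [mul_add, mul_div_cancel₀ _ (hδ n).ne', mul_one]
  have hρT (n : ℕ) {s : ℝ} (hs : s ≤ T) : T / (n + 1 : ℕ) * ⌈s / (T / (n + 1 : ℕ))⌉ ≤ T := by
    have h1 : ⌈s / (T / (n + 1 : ℕ))⌉ ≤ ((n + 1 : ℕ) : ℤ) := by
      rw [Int.ceil_le, div_le_iff₀ (hδ n), Int.cast_natCast, mul_comm, hδT]; exact hs
    calc _ ≤ T / (n + 1 : ℕ) * ((n + 1 : ℕ) : ℝ) := by
          gcongr; exact_mod_cast h1
      _ = T := hδT n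
  have hint (n : ℕ) : ∑ k ∈ Finset.range (n + 1), T / (n + 1 : ℕ) * F (T / (n + 1 : ℕ) * (k + 1))
      = ∫ s in Set.Ioc 0 T, F (T / (n + 1 : ℕ) * ⌈s / (T / (n + 1 : ℕ))⌉) := by
    rw [← integral_comp_ceil (hδ n) F (n + 1), hδT, intervalIntegral.integral_of_le hT.le]
  simp_rw [hint]
  refine tendsto_integral_of_dominated_convergence (fun _ => C) (fun n => ?_) (by simp) (fun n => ?_)
    ?_
  · have h1 : Measurable (fun z : ℤ => F (T / (n + 1 : ℕ) * z)) := measurable_from_top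
    exact (h1.comp (Int.measurable_ceil.comp (measurable_id.div_const _))).aestronglyMeasurable
  · filter_upwards [ae_restrict_mem measurableSet_Ioc] with s hs
    exact hb _ ⟨hs.1.trans_le (hρ n s), hρT n hs.2⟩
  · filter_upwards [ae_restrict_mem measurableSet_Ioc] with s hs
    refine (hc s hs).tendsto.comp (tendsto_nhdsWithin_iff.2 ⟨?_,
      Eventually.of_forall fun n => ⟨hρ n s, hρT n hs.2⟩⟩)
    refine tendsto_of_tendsto_of_tendsto_of_le_of_le tendsto_const_nhds ?_
      (fun n => hρ n s) (fun n => hρ' n s)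
    simpa using hδ0.const_add s

/-- Let `N` be a continuous process whose coordinates at time `t` are sums of Itô integrals
`∑ j, ∫_0^t σ i j dB^j`. Then linear functionals `∑ i, (θ i * N_T i + ∫_0^T κ i s * N_s i ds)`
are centered Gaussian, independent of any variable `U` independent of `B`, and their variance is
the one given by the stochastic Fubini theorem. -/
theorem integral_cexp_add_functional {Ω : Type*} [MeasurableSpace Ω] {P : Measure Ω}
    [IsProbabilityMeasure P] {T : ℝ} (hT : 0 < T) {m d : ℕ} {B : Fin d → ℝ≥0 → Ω → ℝ}
    (hB : IsStdBrownianMotion B P) {U : Ω → ℝ} (hU : AEMeasurable U P)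
    (hind : IndepFun U (fun (ω : Ω) (j : Fin d) (t : ℝ≥0) => B j t ω) P)
    {σ : ℝ → Matrix (Fin m) (Fin d) ℝ} (hσ : ContinuousOn σ (Set.Icc 0 T))
    {N : ℝ → Ω → Fin m → ℝ}
    (hNc : ∀ᵐ ω ∂P, ∀ i, ContinuousOn (fun t => N t ω i) (Set.Icc 0 T))
    (hNI : ∀ t ∈ Set.Icc 0 T, ∃ I : Fin m → Fin d → Ω → ℝ,
      (∀ i j, IsItoIntegral P (B j) (fun s => σ s i j) t (I i j)) ∧
      ∀ᵐ ω ∂P, ∀ i, N t ω i = ∑ j, I i j ω)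
    (θ : Fin m → ℝ) {κ : Fin m → ℝ → ℝ} (hκ : ∀ i, ContinuousOn (κ i) (Set.Icc 0 T)) :
    ∫ ω, Complex.exp ((U ω + ∑ i, (θ i * N T ω i + ∫ s in Set.Ioc 0 T, κ i s * N s ω i) : ℝ)
        * Complex.I) ∂P
      = (∫ ω, Complex.exp (U ω * Complex.I) ∂P) *
        Complex.exp ((-(∑ j, ∫ r in Set.Ioc 0 T, (∑ i, (θ i +
          ∫ s in Set.Ioc 0 T, (Set.Ici r).indicator (κ i) s) * σ r i j) ^ 2) / 2 : ℝ)) := by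
  choose! I hI hNI using hNI
  let τ (n k : ℕ) : ℝ := T / (n + 1 : ℕ) * (k + 1)
  have hτ (n k : ℕ) (hk : k ∈ Finset.range (n + 1)) : τ n k ∈ Set.Icc 0 T := by
    refine ⟨by positivity, ?_⟩
    have h1 : ((k : ℝ) + 1) ≤ (n + 1 : ℕ) := by exact_mod_cast Finset.mem_range.1 hk
    calc τ n k ≤ T / (n + 1 : ℕ) * (n + 1 : ℕ) := by simp only [τ]; gcongr
      _ = T := by field_simp
  have hTm : T ∈ Set.Icc 0 T := ⟨hT.le, le_rfl⟩
  -- entries of `σ` and `κ` are bounded and measurable on `(0, T]`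
  have hσc (i j) : ContinuousOn (fun s => σ s i j) (Set.Icc 0 T) :=
    (continuous_apply_apply i j).comp_continuousOn hσ
  have hσm (i j) : AEStronglyMeasurable (fun s => σ s i j) (volume.restrict (Set.Ioc 0 T)) :=
    ((hσc i j).mono Set.Ioc_subset_Icc_self).aestronglyMeasurable measurableSet_Ioc
  choose S hS using fun i j => isCompact_Icc.exists_bound_of_continuousOn (hσc i j)
  choose C hC using fun i => isCompact_Icc.exists_bound_of_continuousOn (hκ i)
  have hC0 (i) : 0 ≤ C i := (norm_nonneg _).trans (hC i T hTm)
  -- weights of `σ r i j` in the integrand of the `n`-th Riemann sum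
  let a (n : ℕ) (i : Fin m) (r : ℝ) : ℝ := θ i + ∑ k ∈ Finset.range (n + 1),
    T / (n + 1 : ℕ) * (Set.Ici r).indicator (κ i) (τ n k)
  let h (n : ℕ) (j : Fin d) (r : ℝ) : ℝ := ∑ i, (θ i * (Set.Ioc 0 T).indicator (fun s => σ s i j) r
    + ∑ k ∈ Finset.range (n + 1), (T / (n + 1 : ℕ) * κ i (τ n k)) *
      (Set.Ioc 0 (τ n k)).indicator (fun s => σ s i j) r)
  have hha (n j) {r : ℝ} (hr : r ∈ Set.Ioc 0 T) : h n j r = ∑ i, a n i r * σ r i j := by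
    simp only [h, a]
    refine Finset.sum_congr rfl fun i _ => ?_
    rw [add_mul, Finset.sum_mul, Set.indicator_of_mem hr]
    congr 1
    refine Finset.sum_congr rfl fun k _ => ?_
    by_cases hrk : r ≤ τ n k
    · rw [Set.indicator_of_mem (show r ∈ Set.Ioc 0 (τ n k) from ⟨hr.1, hrk⟩),
        Set.indicator_of_mem (show τ n k ∈ Set.Ici r from hrk)]
    · rw [Set.indicator_of_notMem (show r ∉ Set.Ioc 0 (τ n k) from fun h => hrk h.2),
        Set.indicator_of_notMem (show τ n k ∉ Set.Ici r from hrk)]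
      ring
  let J (n : ℕ) (j : Fin d) (ω : Ω) : ℝ := ∑ i, (θ i * I T i j ω
    + ∑ k ∈ Finset.range (n + 1), (T / (n + 1 : ℕ) * κ i (τ n k)) * I (τ n k) i j ω)
  have hW (j) := (hB.isBrownianReal j).toIsPreBrownianReal
  have hm1 (i j) (t : ℝ) : AEStronglyMeasurable ((Set.Ioc 0 t).indicator (fun s => σ s i j))
      (volume.restrict (Set.Ioc 0 T)) := (hσm i j).indicator measurableSet_Ioc
  have hm2 (i j) (c : ℝ) (t : ℝ) : AEStronglyMeasurable
      (fun r => c * (Set.Ioc 0 t).indicator (fun s => σ s i j) r)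
      (volume.restrict (Set.Ioc 0 T)) := (hm1 i j t).const_mul c
  have hm3 (n) (i j) : AEStronglyMeasurable (fun r => ∑ k ∈ Finset.range (n + 1),
      (T / (n + 1 : ℕ) * κ i (τ n k)) * (Set.Ioc 0 (τ n k)).indicator (fun s => σ s i j) r)
      (volume.restrict (Set.Ioc 0 T)) :=
    Finset.aestronglyMeasurable_fun_sum _ fun k _ => hm2 i j _ _
  have hhm (n j) : AEStronglyMeasurable (h n j) (volume.restrict (Set.Ioc 0 T)) :=
    Finset.aestronglyMeasurable_fun_sum _ fun i _ => (hm2 i j _ _).add (hm3 n i j)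
  have hJ (n j) : IsItoIntegral P (B j) (h n j) T (J n j) := by
    refine IsItoIntegral.sum (hW j) _ (fun i _ => (hm2 i j _ _).add (hm3 n i j)) fun i _ => ?_
    refine IsItoIntegral.add (hW j) (hm2 i j _ _) (hm3 n i j)
      (((hI T hTm i j).extend le_rfl).const_mul _) ?_
    exact IsItoIntegral.sum (hW j) _ (fun k _ => hm2 i j _ _) fun k hk =>
      ((hI (τ n k) (hτ n k hk) i j).extend (hτ n k hk).2).const_mul _
  have ha_bound (n i r) : |a n i r| ≤ |θ i| + T * C i := by
    refine (abs_add_le _ _).trans (add_le_add le_rfl ((Finset.abs_sum_le_sum_abs _ _).trans ?_))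
    calc ∑ k ∈ Finset.range (n + 1), |T / (n + 1 : ℕ) * (Set.Ici r).indicator (κ i) (τ n k)|
        ≤ ∑ k ∈ Finset.range (n + 1), T / (n + 1 : ℕ) * C i := by
          refine Finset.sum_le_sum fun k hk => ?_
          rw [abs_mul, abs_of_pos (by positivity : 0 < T / ((n + 1 : ℕ) : ℝ))]
          gcongr
          by_cases hrk : τ n k ∈ Set.Ici r
          · rw [Set.indicator_of_mem hrk]; exact hC i _ (hτ n k hk)
          · rw [Set.indicator_of_notMem hrk, abs_zero]; exact hC0 i
      _ = T * C i := by
          rw [Finset.sum_const, Finset.card_range, nsmul_eq_mul]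
          field_simp
  have hh_bound (n j) {r : ℝ} (hr : r ∈ Set.Ioc 0 T) :
      |h n j r| ≤ ∑ i, (|θ i| + T * C i) * S i j := by
    rw [hha n j hr]
    refine (Finset.abs_sum_le_sum_abs _ _).trans (Finset.sum_le_sum fun i _ => ?_)
    rw [abs_mul]
    have := hC0 i
    exact mul_le_mul (ha_bound n i r) (hS i j r ⟨hr.1.le, hr.2⟩) (abs_nonneg _) (by positivity)
  have hhL (n j) : MemLp (h n j) 2 (volume.restrict (Set.Ioc 0 T)) := by
    refine MemLp.of_bound (hhm n j) (∑ i, (|θ i| + T * C i) * S i j) ?_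
    filter_upwards [ae_restrict_mem measurableSet_Ioc] with r hr using hh_bound n j hr
  have hchar (n) := integral_cexp_add_sum_ito hB hU hind (hhL n) (hJ n)
  -- convergence of the left-hand sides
  have hJae (n) : ∀ᵐ ω ∂P, ∑ j, J n j ω = ∑ i, (θ i * N T ω i + ∑ k ∈ Finset.range (n + 1),
      T / (n + 1 : ℕ) * (κ i (τ n k) * N (τ n k) ω i)) := by
    have hk : ∀ᵐ ω ∂P, ∀ k ∈ Finset.range (n + 1), ∀ i,
        N (τ n k) ω i = ∑ j, I (τ n k) i j ω :=
      (Finset.eventually_all _).2 fun k hk => hNI _ (hτ n k hk)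
    filter_upwards [hk, hNI T hTm] with ω h1 h2
    simp only [J]
    rw [Finset.sum_comm]
    refine Finset.sum_congr rfl fun i _ => ?_
    rw [Finset.sum_add_distrib, ← Finset.mul_sum, ← h2 i, Finset.sum_comm]
    congr 1
    refine Finset.sum_congr rfl fun k hk => ?_
    rw [← Finset.mul_sum, ← h1 k hk i, mul_assoc]
  have hlim1 : ∀ᵐ ω ∂P, Tendsto (fun n => U ω + ∑ j, J n j ω) atTop
      (𝓝 (U ω + ∑ i, (θ i * N T ω i + ∫ s in Set.Ioc 0 T, κ i s * N s ω i))) := by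
    filter_upwards [ae_all_iff.2 hJae, hNc] with ω h1 h2
    simp_rw [h1]
    refine tendsto_const_nhds.add (tendsto_finsetSum _ fun i _ => tendsto_const_nhds.add ?_)
    have hcont : ContinuousOn (fun s => κ i s * N s ω i) (Set.Icc 0 T) := (hκ i).mul (h2 i)
    obtain ⟨D, hD⟩ := isCompact_Icc.exists_bound_of_continuousOn hcont
    exact tendsto_riemann_sum hT (fun s hs => hD s ⟨hs.1.le, hs.2⟩) fun s hs =>
      (hcont s ⟨hs.1.le, hs.2⟩).mono (Set.Icc_subset_Icc_left hs.1.le)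
  have hJm (n j) : AEMeasurable (J n j) P := (hJ n j).1.aestronglyMeasurable.aemeasurable
  have hL := tendsto_integral_cexp (P := P)
    (fun n => hU.add (Finset.aemeasurable_fun_sum _ fun j _ => hJm n j)) hlim1
  -- convergence of the variances
  have hpt (j) {r : ℝ} (hr : r ∈ Set.Ioc 0 T) : Tendsto (fun n => h n j r) atTop
      (𝓝 (∑ i, (θ i + ∫ s in Set.Ioc 0 T, (Set.Ici r).indicator (κ i) s) * σ r i j)) := by
    simp_rw [fun n => hha n j hr]
    refine tendsto_finsetSum _ fun i _ => Tendsto.mul_const _ (tendsto_const_nhds.add ?_)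
    refine tendsto_riemann_sum (C := C i) hT (fun s hs => ?_) fun s hs => ?_
    · by_cases hrs : s ∈ Set.Ici r
      · rw [Set.indicator_of_mem hrs]; exact hC i s ⟨hs.1.le, hs.2⟩
      · rw [Set.indicator_of_notMem hrs, abs_zero]; exact hC0 i
    · rcases le_or_gt r s with hrs | hrs
      · refine (((hκ i) s ⟨hs.1.le, hs.2⟩).mono (Set.Icc_subset_Icc_left hs.1.le)).congr
          (fun u hu => Set.indicator_of_mem (show u ∈ Set.Ici r from hrs.trans hu.1) _)
          (Set.indicator_of_mem (show s ∈ Set.Ici r from hrs) _)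
      · refine (continuousAt_const (y := (0 : ℝ))).congr ?_ |>.continuousWithinAt
        filter_upwards [Iio_mem_nhds hrs] with u hu
        exact (Set.indicator_of_notMem (show u ∉ Set.Ici r from
          fun h => not_lt.2 (Set.mem_Ici.1 h) (Set.mem_Iio.1 hu)) _).symm
  have hvar (j) : Tendsto (fun n => ∫ r in Set.Ioc 0 T, h n j r ^ 2) atTop
      (𝓝 (∫ r in Set.Ioc 0 T, (∑ i, (θ i +
          ∫ s in Set.Ioc 0 T, (Set.Ici r).indicator (κ i) s) * σ r i j) ^ 2)) := by
    refine tendsto_integral_of_dominated_convergence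
      (fun _ => (∑ i, (|θ i| + T * C i) * S i j) ^ 2) (fun n => (hhm n j).pow 2) (by simp)
      (fun n => ?_) ?_
    · filter_upwards [ae_restrict_mem measurableSet_Ioc] with r hr
      rw [norm_pow]
      exact pow_le_pow_left₀ (norm_nonneg _) (hh_bound n j hr) 2
    · filter_upwards [ae_restrict_mem measurableSet_Ioc] with r hr
      exact (hpt j hr).pow 2
  refine tendsto_nhds_unique hL (Tendsto.congr (fun n => (hchar n).symm) ?_)
  refine tendsto_const_nhds.mul ((Complex.continuous_exp.comp
    Complex.continuous_ofReal).continuousAt.tendsto.comp ?_)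
  exact ((tendsto_finsetSum _ fun j _ => hvar j).neg).div_const 2

/-! ### Gaussian mixtures: density, smoothness and score -/

section GaussKernel

variable {E : Type*} [NormedAddCommGroup E] [InnerProductSpace ℝ E] (L M : E ≃L[ℝ] E)

/-- The density at `y` of `M x + L ξ`, with `ξ` standard Gaussian, up to a factor that depends
neither on `x` nor on `y`. -/
noncomputable def gaussKernel (y x : E) : ℝ := Real.exp (-‖L.symm (y - M x)‖ ^ 2 / 2)

lemma gaussKernel_pos (y x : E) : 0 < gaussKernel L M y x := Real.exp_pos _

lemma continuous_gaussKernel : Continuous (fun z : E × E => gaussKernel L M z.1 z.2) := by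
  unfold gaussKernel; fun_prop

lemma gaussKernel_le_one (y x : E) : gaussKernel L M y x ≤ 1 := by
  unfold gaussKernel
  rw [Real.exp_le_one_iff]
  have := sq_nonneg ‖L.symm (y - M x)‖
  linarith

lemma integrable_gaussKernel [MeasurableSpace E] [BorelSpace E] [SecondCountableTopology E]
    (μ : Measure E) [IsProbabilityMeasure μ] (y : E) : Integrable (gaussKernel L M y) μ := by
  refine Integrable.of_bound (C := 1) ?_ (Eventually.of_forall fun x => ?_)
  · exact ((continuous_gaussKernel L M).comp
      (by fun_prop : Continuous fun x : E => (y, x))).aestronglyMeasurable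
  · rw [Real.norm_of_nonneg (gaussKernel_pos L M y x).le]; exact gaussKernel_le_one L M y x

end GaussKernel

section GaussianIntegral


variable {E : Type*} [NormedAddCommGroup E] [InnerProductSpace ℝ E] [FiniteDimensional ℝ E]
  [MeasurableSpace E] [BorelSpace E]

lemma integrable_exp_neg_sq_norm : Integrable (fun x : E => Real.exp (-‖x‖ ^ 2 / 2)) := by
  have h := GaussianFourier.integrable_cexp_neg_mul_sq_norm_add (V := E) (b := 1 / 2)
    (by norm_num) 0 0
  have := h.norm
  refine this.congr (Eventually.of_forall fun x => ?_)
  simp only [Complex.norm_exp]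
  congr 1
  have : (-(1 / 2 : ℂ) * (‖x‖ : ℂ) ^ 2 + 0 * ((inner ℝ (0 : E) x : ℝ) : ℂ))
      = ((-‖x‖ ^ 2 / 2 : ℝ) : ℂ) := by push_cast; ring
  rw [this, Complex.ofReal_re]

/-- The standard Gaussian measure is defined by its components in an orthonormal basis; its
Lebesgue density is identified by comparing characteristic functions. -/
lemma stdGaussian_eq_withDensity :
    stdGaussian E = volume.withDensity (fun x => ENNReal.ofReal
      ((2 * Real.pi) ^ (-(Module.finrank ℝ E : ℝ) / 2) * Real.exp (-‖x‖ ^ 2 / 2))) := by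
  have hint : Integrable (fun x : E =>
      (2 * Real.pi) ^ (-(Module.finrank ℝ E : ℝ) / 2) * Real.exp (-‖x‖ ^ 2 / 2)) :=
    integrable_exp_neg_sq_norm.const_mul _
  have hpos : 0 < (2 * Real.pi) ^ (-(Module.finrank ℝ E : ℝ) / 2) := by positivity
  have : IsFiniteMeasure ((volume : Measure E).withDensity (fun x => ENNReal.ofReal
      ((2 * Real.pi) ^ (-(Module.finrank ℝ E : ℝ) / 2) * Real.exp (-‖x‖ ^ 2 / 2)))) :=
    isFiniteMeasure_withDensity_ofReal hint.2
  refine Measure.ext_of_charFun (funext fun t => ?_)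
  rw [charFun_stdGaussian, charFun_apply, integral_withDensity_eq_integral_toReal_smul
    (by fun_prop) (Eventually.of_forall fun _ => ENNReal.ofReal_lt_top)]
  have h := GaussianFourier.integral_cexp_neg_mul_sq_norm_add (V := E) (b := 1 / 2)
    (by norm_num) Complex.I t
  have e (x : E) : (ENNReal.ofReal ((2 * Real.pi) ^ (-(Module.finrank ℝ E : ℝ) / 2) *
      Real.exp (-‖x‖ ^ 2 / 2))).toReal • Complex.exp ((inner ℝ x t : ℝ) * Complex.I)
      = (((2 * Real.pi) ^ (-(Module.finrank ℝ E : ℝ) / 2) : ℝ) : ℂ) *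
        Complex.exp (-(1 / 2) * (‖x‖ : ℂ) ^ 2 + Complex.I * (inner ℝ t x : ℝ)) := by
    rw [ENNReal.toReal_ofReal (by positivity), Complex.real_smul, Complex.exp_add,
      real_inner_comm]
    push_cast
    rw [mul_assoc]
    congr 2
    · congr 1; ring
    · congr 1; ring
  simp_rw [e]
  rw [integral_const_mul, h]
  -- the normalizing constant cancels the total mass `(2π) ^ (n / 2)` of `exp (-‖x‖ ^ 2 / 2)`
  have hc : (((2 * Real.pi) ^ (-(Module.finrank ℝ E : ℝ) / 2) : ℝ) : ℂ) *
      ((Real.pi : ℂ) / (1 / 2)) ^ ((Module.finrank ℝ E : ℂ) / 2) = 1 := by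
    have : ((Real.pi : ℂ) / (1 / 2)) ^ ((Module.finrank ℝ E : ℂ) / 2)
        = (((2 * Real.pi) ^ ((Module.finrank ℝ E : ℝ) / 2) : ℝ) : ℂ) := by
      rw [Complex.ofReal_cpow (by positivity)]
      push_cast
      congr 1; ring
    rw [this, ← Complex.ofReal_mul, ← Real.rpow_add (by positivity)]
    simp [neg_div]
  rw [← mul_assoc, hc, one_mul]
  congr 1
  rw [Complex.I_sq]; ring

/-- Integration against the image of the standard Gaussian measure under `x ↦ a + L x`, with
respect to Lebesgue measure. -/
lemma exists_lintegral_stdGaussian_comp_eq (L : E ≃L[ℝ] E) :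
    ∃ K : ℝ, 0 < K ∧ ∀ (a : E) (F : E → ℝ≥0∞), Measurable F →
      ∫⁻ x, F (a + L x) ∂(stdGaussian E)
        = ∫⁻ y, F y * ENNReal.ofReal (K * Real.exp (-‖L.symm (y - a)‖ ^ 2 / 2)) := by
  have hdet : LinearMap.det (L : E →ₗ[ℝ] E) ≠ 0 := (LinearEquiv.isUnit_det' L.toLinearEquiv).ne_zero
  refine ⟨|(LinearMap.det (L : E →ₗ[ℝ] E))⁻¹| *
    (2 * Real.pi) ^ (-(Module.finrank ℝ E : ℝ) / 2), by positivity, fun a F hF => ?_⟩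
  rw [stdGaussian_eq_withDensity, lintegral_withDensity_eq_lintegral_mul _ (by fun_prop)
    (by fun_prop)]
  have hG : Measurable (fun z : E => ENNReal.ofReal ((2 * Real.pi) ^
      (-(Module.finrank ℝ E : ℝ) / 2) * Real.exp (-‖L.symm z‖ ^ 2 / 2)) * F (a + z)) := by
    fun_prop
  have h1 := lintegral_map (μ := (volume : Measure E)) hG (L.continuous.measurable)
  have h2 := Measure.map_linearMap_addHaar_eq_smul_addHaar (volume : Measure E) hdet
  have h3 : ((L : E →ₗ[ℝ] E) : E → E) = L := rfl
  rw [h3] at h2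
  rw [h2, lintegral_smul_measure] at h1
  simp only [ContinuousLinearEquiv.symm_apply_apply] at h1
  simp only [Pi.mul_apply]
  rw [← h1, ← lintegral_sub_right_eq_self (μ := (volume : Measure E)) _ a, smul_eq_mul,
    ← lintegral_const_mul _ (by fun_prop)]
  refine lintegral_congr fun y => ?_
  rw [add_sub_cancel, ← mul_assoc, ← ENNReal.ofReal_mul (abs_nonneg _), mul_comm, mul_assoc]

/-- The convolution of a finite measure with a Gaussian function is smooth, being the Fourier
transform of a bounded function against a Gaussian measure, all of whose moments are finite. -/
lemma contDiff_integral_exp_neg_sq_norm_sub (ν : Measure E) [IsFiniteMeasure ν] :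
    ContDiff ℝ ((⊤ : ℕ∞) : WithTop ℕ∞) (fun u => ∫ v, Real.exp (-‖u - v‖ ^ 2 / 2) ∂ν) := by
  -- `-1 / (2π)` undoes the normalization `exp (-2πi Λ(θ, u))` of Mathlib's Fourier transform
  let Λ : E →L[ℝ] E →L[ℝ] ℝ := (-(2 * Real.pi)⁻¹) • innerSL ℝ
  have hsm : ContDiff ℝ ((⊤ : ℕ∞) : WithTop ℕ∞) (VectorFourier.fourierIntegral Real.fourierChar
      (stdGaussian E) Λ.toLinearMap₁₂ (fun θ => charFun ν (-θ))) := by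
    refine VectorFourier.contDiff_fourierIntegral Λ fun n _ => ?_
    have hn : Integrable (fun θ : E => ‖θ‖ ^ n) (stdGaussian E) := by
      have := (IsGaussian.memLp_id (stdGaussian E) n (by simp)).integrable_norm_pow' (p := n)
      simpa using this
    refine (hn.mul_const (ν.real Set.univ)).mono' ?_ (Eventually.of_forall fun θ => ?_)
    · have : Measurable (fun θ : E => charFun ν (-θ)) := measurable_charFun.comp measurable_neg
      exact AEMeasurable.aestronglyMeasurable (by fun_prop)
    · rw [norm_mul, norm_norm, norm_pow, norm_norm]
      gcongr
      exact norm_charFun_le _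
  have heq : (fun u => ∫ v, Real.exp (-‖u - v‖ ^ 2 / 2) ∂ν)
      = Complex.reCLM ∘ VectorFourier.fourierIntegral Real.fourierChar
      (stdGaussian E) Λ.toLinearMap₁₂ (fun θ => charFun ν (-θ)) := by
    ext u
    have h1 : ((∫ v, Real.exp (-‖u - v‖ ^ 2 / 2) ∂ν : ℝ) : ℂ)
        = ∫ v, ∫ θ, Complex.exp ((inner ℝ θ (u - v) : ℝ) * Complex.I) ∂(stdGaussian E) ∂ν := by
      rw [← integral_complex_ofReal]
      refine integral_congr_ae (Eventually.of_forall fun v => ?_)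
      simp only
      rw [← charFun_apply, charFun_stdGaussian]
      push_cast; rfl
    have h2 : VectorFourier.fourierIntegral Real.fourierChar
        (stdGaussian E) Λ.toLinearMap₁₂ (fun θ => charFun ν (-θ)) u
        = ∫ θ, ∫ v, Complex.exp ((inner ℝ θ (u - v) : ℝ) * Complex.I) ∂ν ∂(stdGaussian E) := by
      unfold VectorFourier.fourierIntegral
      refine integral_congr_ae (Eventually.of_forall fun θ => ?_)
      simp only
      rw [charFun_apply, Circle.smul_def, smul_eq_mul, ← integral_const_mul]
      refine integral_congr_ae (Eventually.of_forall fun v => ?_)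
      simp only
      rw [Real.fourierChar_apply, ← Complex.exp_add]
      congr 1
      have : Λ.toLinearMap₁₂ θ u = -(2 * Real.pi)⁻¹ * inner ℝ θ u := by
        simp [Λ, innerSL_apply_apply ℝ]
      rw [this, inner_neg_right, inner_sub_right, real_inner_comm v θ]
      have hpi : (Real.pi : ℂ) ≠ 0 := by exact_mod_cast Real.pi_ne_zero
      push_cast
      field_simp
      ring
    have h3 : Integrable (Function.uncurry fun (v θ : E) =>
        Complex.exp ((inner ℝ θ (u - v) : ℝ) * Complex.I)) (ν.prod (stdGaussian E)) := by
      refine Integrable.of_bound (C := 1) ?_ (Eventually.of_forall fun z => ?_)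
      · exact Continuous.aestronglyMeasurable (by unfold Function.uncurry; fun_prop)
      · simp [Function.uncurry, Complex.norm_exp_ofReal_mul_I]
    rw [Function.comp_apply, h2, ← integral_integral_swap h3, ← h1]
    simp
  rw [heq]
  exact Complex.reCLM.contDiff.comp hsm

lemma mul_exp_neg_sq_half_le_one (r : ℝ) : r * Real.exp (-r ^ 2 / 2) ≤ 1 := by
  have h1 : r ≤ Real.exp (r ^ 2 / 2) := by
    have := Real.add_one_le_exp (r ^ 2 / 2)
    nlinarith [sq_nonneg (r - 1)]
  calc r * Real.exp (-r ^ 2 / 2) ≤ Real.exp (r ^ 2 / 2) * Real.exp (-r ^ 2 / 2) := by gcongr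
    _ = 1 := by rw [← Real.exp_add]; simp [neg_div]

variable (L M : E ≃L[ℝ] E) (μ : Measure E) [IsProbabilityMeasure μ]

lemma integral_gaussKernel_pos (y : E) : 0 < ∫ x, gaussKernel L M y x ∂μ := by
  rw [integral_pos_iff_support_of_nonneg (fun x => (gaussKernel_pos L M y x).le)
    (integrable_gaussKernel L M μ y)]
  have : Function.support (gaussKernel L M y) = Set.univ :=
    Set.eq_univ_of_forall fun x => (gaussKernel_pos L M y x).ne'
  simp [this]

/-- A Gaussian weight `exp (-‖L⁻¹ (y - M x)‖² / 2)` has finite first moment against any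
probability measure in `x`, since `M` and `L` are invertible. -/
lemma integrable_gaussKernel_smul (y : E) : Integrable (fun x => gaussKernel L M y x • x) μ := by
  refine Integrable.of_bound (C := ‖(M.symm : E →L[ℝ] E)‖ * (‖y‖ + ‖(L : E →L[ℝ] E)‖)) ?_
    (Eventually.of_forall fun x => ?_)
  · refine Continuous.aestronglyMeasurable (Continuous.smul ?_ continuous_id)
    exact (continuous_gaussKernel L M).comp (by fun_prop : Continuous fun x : E => (y, x))
  · set w := L.symm (y - M x) with hw
    have hx : x = M.symm (y - L w) := by simp [hw]
    have h1 : ‖x‖ ≤ ‖(M.symm : E →L[ℝ] E)‖ * (‖y‖ + ‖(L : E →L[ℝ] E)‖ * ‖w‖) := by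
      conv_lhs => rw [hx]
      refine ((M.symm : E →L[ℝ] E).le_opNorm _).trans ?_
      gcongr
      refine (norm_sub_le _ _).trans ?_
      gcongr
      exact (L : E →L[ℝ] E).le_opNorm _
    have h2 : gaussKernel L M y x = Real.exp (-‖w‖ ^ 2 / 2) := rfl
    have h3 := mul_exp_neg_sq_half_le_one ‖w‖
    have h4 := gaussKernel_le_one L M y x
    have h5 := (gaussKernel_pos L M y x).le
    rw [norm_smul, Real.norm_of_nonneg h5]
    rw [← h2] at h3
    calc gaussKernel L M y x * ‖x‖ ≤ gaussKernel L M y x *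
          (‖(M.symm : E →L[ℝ] E)‖ * (‖y‖ + ‖(L : E →L[ℝ] E)‖ * ‖w‖)) := by gcongr
      _ = ‖(M.symm : E →L[ℝ] E)‖ * (gaussKernel L M y x * ‖y‖ +
          ‖(L : E →L[ℝ] E)‖ * (‖w‖ * gaussKernel L M y x)) := by ring
      _ ≤ ‖(M.symm : E →L[ℝ] E)‖ * (1 * ‖y‖ + ‖(L : E →L[ℝ] E)‖ * 1) := by gcongr
      _ = _ := by ring

lemma contDiff_integral_gaussKernel :
    ContDiff ℝ ((⊤ : ℕ∞) : WithTop ℕ∞) (fun y => ∫ x, gaussKernel L M y x ∂μ) := by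
  have hm : Measurable fun x => L.symm (M x) := by fun_prop
  have : IsProbabilityMeasure (μ.map fun x => L.symm (M x)) :=
    Measure.isProbabilityMeasure_map hm.aemeasurable
  have h := (contDiff_integral_exp_neg_sq_norm_sub (μ.map fun x => L.symm (M x))).comp
    L.symm.contDiff
  convert h using 1
  ext y
  simp only [Function.comp_apply]
  rw [integral_map hm.aemeasurable (Continuous.aestronglyMeasurable (by fun_prop))]
  simp [gaussKernel]

/-- Differentiation under the integral sign: the gradient of the kernel in `y` is bounded uniformly
in `x`, because `r * exp (-r ^ 2 / 2) ≤ 1`. -/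
lemma hasGradientAt_integral_gaussKernel (y : E) :
    HasGradientAt (fun y => ∫ x, gaussKernel L M y x ∂μ)
      (-((L.symm : E →L[ℝ] E).adjoint (L.symm ((∫ x, gaussKernel L M y x ∂μ) • y -
        M (∫ x, gaussKernel L M y x • x ∂μ))))) y := by
  let A : E →L[ℝ] E := (L.symm : E →L[ℝ] E)
  let D : E → E → E := fun y x => -(A.adjoint (A (gaussKernel L M y x • (y - M x))))
  have hD (y x) : HasFDerivAt (fun y => gaussKernel L M y x) (innerSL ℝ (D y x)) y := by
    have h1 : HasFDerivAt (fun y => A (y - M x)) A y :=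
      A.hasFDerivAt.comp y ((hasFDerivAt_id y).sub_const _)
    have h2 := (((h1.norm_sq).neg.mul_const (1 / 2 : ℝ))).exp
    have e : (fun y => gaussKernel L M y x) =
        fun y => Real.exp (-‖A (y - M x)‖ ^ 2 * (1 / 2)) := by
      ext y; unfold gaussKernel; congr 1; rw [mul_one_div]; rfl
    rw [e]
    refine h2.congr_fderiv ?_
    ext v
    have h3 : gaussKernel L M y x = Real.exp (-‖A (y - M x)‖ ^ 2 * (1 / 2)) :=
      congrFun e y
    simp only [D, h3, innerSL_apply_apply, inner_neg_left, ContinuousLinearMap.adjoint_inner_left,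
      map_smul, inner_smul_left]
    simp only [_root_.smul_apply, _root_.neg_apply,
      ContinuousLinearMap.comp_apply, innerSL_apply_apply, conj_trivial, Pi.neg_apply,
      smul_eq_mul, nsmul_eq_mul, Nat.cast_ofNat]
    ring
  have hDn (y x) : ‖D y x‖ ≤ ‖A.adjoint‖ := by
    simp only [D]
    rw [norm_neg, map_smul]
    refine (A.adjoint.le_opNorm _).trans ?_
    refine mul_le_of_le_one_right (norm_nonneg _) ?_
    rw [norm_smul, Real.norm_of_nonneg (gaussKernel_pos L M y x).le, mul_comm]
    exact mul_exp_neg_sq_half_le_one _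
  have hcont : Continuous (fun x => gaussKernel L M y x) :=
    (continuous_gaussKernel L M).comp (by fun_prop : Continuous fun x : E => (y, x))
  have hDc : Continuous (fun x => D y x) := by
    simp only [D]; fun_prop
  have key := hasFDerivAt_integral_of_dominated_of_fderiv_le (μ := μ) (x₀ := y) (s := Set.univ)
    (F := fun y x => gaussKernel L M y x) (F' := fun y x => innerSL ℝ (D y x))
    (bound := fun _ => ‖A.adjoint‖) univ_mem
    (Eventually.of_forall fun y => (integrable_gaussKernel L M μ y).aestronglyMeasurable)
    (integrable_gaussKernel L M μ y)
    (((innerSL ℝ).continuous.comp hDc).aestronglyMeasurable)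
    (Eventually.of_forall fun x y _ => by rw [innerSL_apply_norm]; exact hDn y x)
    (integrable_const _) (Eventually.of_forall fun x y _ => hD y x)
  rw [hasGradientAt_iff_hasFDerivAt]
  refine key.congr_fderiv ?_
  have hDi : Integrable (fun x => D y x) μ :=
    Integrable.of_bound hDc.aestronglyMeasurable _ (Eventually.of_forall fun x => hDn y x)
  have e1 : ∫ x, innerSL ℝ (D y x) ∂μ = innerSL ℝ (∫ x, D y x ∂μ) :=
    (innerSL ℝ : E →L[ℝ] E →L[ℝ] ℝ).integral_comp_comm hDi
  have hi1 : Integrable (fun x => gaussKernel L M y x • y) μ :=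
    (integrable_gaussKernel L M μ y).smul_const y
  have hi2 := integrable_gaussKernel_smul L M μ y
  have hi3 : Integrable (fun x => M (gaussKernel L M y x • x)) μ :=
    (M : E →L[ℝ] E).integrable_comp hi2
  have e2 : ∫ x, D y x ∂μ = -((L.symm : E →L[ℝ] E).adjoint (L.symm
      ((∫ x, gaussKernel L M y x ∂μ) • y - M (∫ x, gaussKernel L M y x • x ∂μ)))) := by
    have e3 (x) : D y x = -((A.adjoint ∘L A) (gaussKernel L M y x • y -
        M (gaussKernel L M y x • x))) := by
      simp [D, smul_sub]
    simp_rw [e3]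
    have e5 := (A.adjoint ∘L A).integral_comp_comm (hi1.sub hi3)
    simp only [Pi.sub_apply] at e5
    rw [integral_neg, e5, integral_sub hi1 hi3, integral_smul_const]
    have e4 := (M : E →L[ℝ] E).integral_comp_comm hi2
    simp only [ContinuousLinearEquiv.coe_coe] at e4
    rw [e4]
    rfl
  rw [e1, e2]
  ext v
  simp

/-- If `XT = M X0 + L ξ` in joint law, with `ξ` standard Gaussian and independent of `X0`, then
`XT` has a smooth positive density whose score is expressed by the conditional mean of `X0`
given `XT`. -/
theorem exists_density_of_map_eq {Ω : Type*} [MeasurableSpace Ω] {P : Measure Ω}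
    [IsProbabilityMeasure P] {X0 XT : Ω → E} (hX0 : AEMeasurable X0 P) (hXT : AEMeasurable XT P)
    (hlaw : P.map (fun ω => (X0 ω, XT ω)) =
      (μ.prod (stdGaussian E)).map (fun z => (z.1, M z.1 + L z.2))) :
    ∃ p : E → ℝ, ContDiff ℝ ((⊤ : ℕ∞) : WithTop ℕ∞) p ∧ (∀ y, 0 < p y) ∧
      P.map XT = volume.withDensity (fun y => ENNReal.ofReal (p y)) ∧
      ∀ᵐ y ∂(volume : Measure E),
        Integrable (fun x => x) (condDistrib X0 XT P y) ∧
        HasGradientAt (fun z => Real.log (p z))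
          (-((L.symm : E →L[ℝ] E).adjoint (L.symm
            (y - M (∫ x, x ∂(condDistrib X0 XT P y)))))) y := by
  obtain ⟨K, hK, hKF⟩ := exists_lintegral_stdGaussian_comp_eq L
  obtain ⟨Z, hZ⟩ : ∃ Z : E → ℝ, (fun y => ∫ x, gaussKernel L M y x ∂μ) = Z := ⟨_, rfl⟩
  have hZ' (y : E) : ∫ x, gaussKernel L M y x ∂μ = Z y := congrFun hZ y
  have hZpos (y : E) : 0 < Z y := hZ' y ▸ integral_gaussKernel_pos L M μ y
  have hZsm : ContDiff ℝ ((⊤ : ℕ∞) : WithTop ℕ∞) Z := hZ ▸ contDiff_integral_gaussKernel L M μ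
  have hKZm : Measurable (fun y => ENNReal.ofReal (K * Z y)) :=
    (hZsm.continuous.measurable.const_mul K).ennreal_ofReal
  have hZm : Measurable Z := hZsm.continuous.measurable
  have hgm : Measurable (fun z : E × E => gaussKernel L M z.1 z.2) :=
    (continuous_gaussKernel L M).measurable
  -- in the joint law, Tonelli exchanges the integrals over `x` and `y`
  have hjoint (F : E × E → ℝ≥0∞) (hF : Measurable F) :
      ∫⁻ z, F z ∂(P.map (fun ω => (XT ω, X0 ω)))
        = ∫⁻ y, ∫⁻ x, F (y, x) * ENNReal.ofReal (K * gaussKernel L M y x) ∂μ := by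
    have h1 : P.map (fun ω => (XT ω, X0 ω)) =
        (P.map (fun ω => (X0 ω, XT ω))).map Prod.swap := by
      rw [AEMeasurable.map_map_of_aemeasurable (by fun_prop) (by fun_prop)]
      rfl
    rw [h1, hlaw, Measure.map_map (by fun_prop) (by fun_prop), lintegral_map hF (by fun_prop),
      lintegral_prod _ (by fun_prop)]
    simp only [Function.comp_apply, Prod.swap_prod_mk]
    have h2 (x : E) : ∫⁻ g, F (M x + L g, x) ∂(stdGaussian E)
        = ∫⁻ y, F (y, x) * ENNReal.ofReal (K * gaussKernel L M y x) :=
      hKF (M x) (fun y => F (y, x)) (by fun_prop)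
    simp_rw [h2]
    refine lintegral_lintegral_swap (Measurable.aemeasurable ?_)
    have := (hF.mul (hgm.const_mul K).ennreal_ofReal).comp (measurable_swap (α := E) (β := E))
    exact this
  have hmass (y : E) : ∫⁻ x, ENNReal.ofReal (K * gaussKernel L M y x) ∂μ
      = ENNReal.ofReal (K * Z y) := by
    rw [← ofReal_integral_eq_lintegral_ofReal ((integrable_gaussKernel L M μ y).const_mul K)
      (Eventually.of_forall fun x => (mul_pos hK (gaussKernel_pos L M y x)).le),
      integral_const_mul, hZ']
  have hmap : P.map XT = volume.withDensity (fun y => ENNReal.ofReal (K * Z y)) := by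
    refine Measure.ext_of_lintegral _ fun F hF => ?_
    have h1 : P.map XT = (P.map (fun ω => (XT ω, X0 ω))).map Prod.fst := by
      rw [AEMeasurable.map_map_of_aemeasurable (by fun_prop) (by fun_prop)]
      rfl
    rw [h1, lintegral_map hF measurable_fst, hjoint (fun z => F z.1) (hF.comp measurable_fst),
      lintegral_withDensity_eq_lintegral_mul _ hKZm hF]
    refine lintegral_congr fun y => ?_
    have hgy : Measurable fun x => ENNReal.ofReal (K * gaussKernel L M y x) := by
      have h := (hgm.const_mul K).ennreal_ofReal.comp (measurable_prodMk_left (x := y))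
      exact h
    simp only [Pi.mul_apply]
    rw [lintegral_const_mul _ hgy, hmass, mul_comm]
  -- the conditional law of `X0` given `XT = y` has density `gaussKernel y x / Z y` w.r.t. `μ`
  let f : E → E → ℝ≥0∞ := fun y x => ENNReal.ofReal (gaussKernel L M y x / Z y)
  have hf : Measurable (Function.uncurry f) := by
    simp only [f, Function.uncurry_def]
    fun_prop
  let κ : Kernel E E := Kernel.withDensity (Kernel.const E μ) f
  have hκ (y : E) : κ y = μ.withDensity (f y) := by
    simp only [κ]
    rw [Kernel.withDensity_apply _ hf, Kernel.const_apply]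
  have hκprob : IsMarkovKernel κ := by
    refine ⟨fun y => ⟨?_⟩⟩
    rw [hκ, withDensity_apply _ MeasurableSet.univ, Measure.restrict_univ]
    simp only [f]
    rw [← ofReal_integral_eq_lintegral_ofReal ((integrable_gaussKernel L M μ y).div_const _)
      (Eventually.of_forall fun x => (div_pos (gaussKernel_pos L M y x) (hZpos y)).le),
      integral_div, hZ', div_self (hZpos y).ne', ENNReal.ofReal_one]
  have hcomp : P.map (fun ω => (XT ω, X0 ω)) = P.map XT ⊗ₘ κ := by
    refine Measure.ext_of_lintegral _ fun F hF => ?_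
    rw [hjoint F hF, Measure.lintegral_compProd hF, hmap,
      lintegral_withDensity_eq_lintegral_mul _ hKZm hF.lintegral_kernel_prod_right']
    refine lintegral_congr fun y => ?_
    have hFy : Measurable fun x => F (y, x) := by fun_prop
    have hfy : Measurable (f y) := hf.of_uncurry_left
    simp only [Pi.mul_apply]
    rw [hκ, lintegral_withDensity_eq_lintegral_mul _ hfy hFy, ← lintegral_const_mul _ (hfy.mul hFy)]
    refine lintegral_congr fun x => ?_
    simp only [Pi.mul_apply, f]
    rw [← mul_assoc, ← ENNReal.ofReal_mul (mul_pos hK (hZpos y)).le, mul_comm]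
    congr 2
    have := (hZpos y).ne'
    field_simp
  have hcond := condDistrib_ae_eq_of_measure_eq_compProd XT hX0 hcomp
  have hac : (volume : Measure E) ≪ P.map XT := by
    rw [hmap]
    refine withDensity_absolutelyContinuous' hKZm.aemeasurable (Eventually.of_forall fun y => ?_)
    simpa using mul_pos hK (hZpos y)
  refine ⟨fun y => K * Z y, contDiff_const.mul hZsm, fun y => mul_pos hK (hZpos y), hmap, ?_⟩
  filter_upwards [hac.ae_le hcond] with y hy
  have hfy : Measurable (f y) := hf.of_uncurry_left
  have hft : ∀ᵐ x ∂μ, f y x < ⊤ := Eventually.of_forall fun x => ENNReal.ofReal_lt_top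
  have hfr (x : E) : (f y x).toReal = gaussKernel L M y x / Z y :=
    ENNReal.toReal_ofReal (div_pos (gaussKernel_pos L M y x) (hZpos y)).le
  have hsm (x : E) : (f y x).toReal • x = (Z y)⁻¹ • (gaussKernel L M y x • x) := by
    rw [hfr, smul_smul]; congr 1; ring
  rw [hy, hκ]
  have hmean : ∫ x, x ∂(μ.withDensity (f y)) = (Z y)⁻¹ • ∫ x, gaussKernel L M y x • x ∂μ := by
    rw [integral_withDensity_eq_integral_toReal_smul hfy hft]
    simp_rw [hsm]
    rw [integral_smul]
  refine ⟨?_, ?_⟩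
  · rw [integrable_withDensity_iff_integrable_smul' hfy hft]
    simp_rw [hsm]
    exact (integrable_gaussKernel_smul L M μ y).smul _
  · rw [hmean]
    have hg := (hasGradientAt_integral_gaussKernel L M μ y).hasFDerivAt
    rw [hZ, hZ'] at hg
    have hlog := (hg.const_mul K).log (mul_pos hK (hZpos y)).ne'
    rw [hasGradientAt_iff_hasFDerivAt]
    refine hlog.congr_fderiv ?_
    ext v
    have hz := (hZpos y).ne'
    have hv : y - M ((Z y)⁻¹ • ∫ x, gaussKernel L M y x • x ∂μ)
        = (Z y)⁻¹ • (Z y • y - M (∫ x, gaussKernel L M y x • x ∂μ)) := by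
      rw [smul_sub, smul_smul, inv_mul_cancel₀ hz, one_smul, map_smul]
    rw [hv, map_smul, map_smul]
    simp only [_root_.smul_apply, InnerProductSpace.toDual_apply_apply,
      inner_neg_left, inner_smul_left, smul_eq_mul, conj_trivial]
    field_simp

end GaussianIntegral

open scoped MatrixOrder

/-! ### The law of the pair `(X_0, X_T)` -/

section Gamma

variable {m d : ℕ} {T : ℝ} {b Y : ℝ → Matrix (Fin m) (Fin m) ℝ} {σ : ℝ → Matrix (Fin m) (Fin d) ℝ}

lemma IsFirstVariation.continuousOn_kernel (hY : IsFirstVariation b T Y)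
    (hb : ContinuousOn b (Set.Icc 0 T)) (hσ : ContinuousOn σ (Set.Icc 0 T)) (i : Fin m)
    (j : Fin d) : ContinuousOn (fun r => (Y T * (Y r)⁻¹ * σ r) i j) (Set.Icc 0 T) := by
  have h1 : ContinuousOn (fun r => Y T * (Y r)⁻¹) (Set.Icc 0 T) :=
    (continuous_const.matrix_mul continuous_id).comp_continuousOn (hY.continuousOn_inv hb)
  have h2 : ContinuousOn (fun r => Y T * (Y r)⁻¹ * σ r) (Set.Icc 0 T) :=
    (continuous_fst.matrix_mul continuous_snd).comp_continuousOn (h1.prodMk hσ)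
  exact (continuous_apply_apply i j).comp_continuousOn h2

/-- The quadratic form of `γ` is the variance of `∑ i, θ i (∫_0^T Y_T Y_r⁻¹ σ(r) dB_r)_i`. -/
lemma dotProduct_gammaMatrix_mulVec (hT : 0 ≤ T) (hY : IsFirstVariation b T Y)
    (hb : ContinuousOn b (Set.Icc 0 T)) (hσ : ContinuousOn σ (Set.Icc 0 T)) (θ : Fin m → ℝ) :
    θ ⬝ᵥ gammaMatrix σ T Y *ᵥ θ =
      ∑ j, ∫ r in Set.Ioc 0 T, (∑ l, θ l * (Y T * (Y r)⁻¹ * σ r) l j) ^ 2 := by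
  set Q : ℝ → Matrix (Fin m) (Fin m) ℝ := fun r => (Y r)⁻¹ * σ r * (σ r)ᵀ * ((Y r)⁻¹)ᵀ with hQ
  set η : Fin m → ℝ := (Y T)ᵀ *ᵥ θ with hη
  have hinv := hY.continuousOn_inv hb
  have hR : ContinuousOn (fun r => (Y r)⁻¹ * σ r) (Set.Icc 0 T) :=
    (continuous_fst.matrix_mul continuous_snd).comp_continuousOn (hinv.prodMk hσ)
  have hQc : ContinuousOn Q (Set.Icc 0 T) := by
    have h : Continuous fun A : Matrix (Fin m) (Fin d) ℝ => A * Aᵀ :=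
      continuous_id.matrix_mul continuous_id.matrix_transpose
    refine (h.comp_continuousOn hR).congr fun r _ => ?_
    simp [hQ, transpose_mul, Matrix.mul_assoc]
  have hQi (i l) : Integrable (fun r => Q r i l) (volume.restrict (Set.Ioc 0 T)) :=
    (((continuous_apply_apply i l).comp_continuousOn hQc).integrableOn_Icc).mono_set
      Set.Ioc_subset_Icc_self
  have hquad (r : ℝ) : ∑ i, ∑ l, η i * Q r i l * η l
      = ∑ j, (∑ l, θ l * (Y T * (Y r)⁻¹ * σ r) l j) ^ 2 := by
    have h1 : ∑ i, ∑ l, η i * Q r i l * η l = η ⬝ᵥ Q r *ᵥ η := by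
      simp only [dotProduct, mulVec, Finset.mul_sum, mul_assoc]
    have h2 : Q r = ((Y r)⁻¹ * σ r) * ((Y r)⁻¹ * σ r)ᵀ := by
      simp [hQ, transpose_mul, Matrix.mul_assoc]
    have h3 : ((Y r)⁻¹ * σ r)ᵀ *ᵥ η = (Y T * (Y r)⁻¹ * σ r)ᵀ *ᵥ θ := by
      rw [hη, mulVec_mulVec, ← transpose_mul, Matrix.mul_assoc]
    rw [h1, h2, ← mulVec_mulVec, dotProduct_mulVec, ← mulVec_transpose, h3]
    simp only [dotProduct, mulVec, transpose_apply, sq, mul_comm]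
  have hγ : θ ⬝ᵥ gammaMatrix σ T Y *ᵥ θ
      = ∑ i, ∑ l, η i * (∫ r in Set.Ioc 0 T, Q r i l) * η l := by
    rw [gammaMatrix, ← mulVec_mulVec, ← mulVec_mulVec, dotProduct_mulVec, ← mulVec_transpose,
      ← hη]
    clear_value η
    simp only [dotProduct, Finset.mul_sum, mul_assoc, mulVec, of_apply,
      intervalIntegral.integral_of_le hT, hQ]
  rw [hγ]
  have e (i l) : η i * (∫ r in Set.Ioc 0 T, Q r i l) * η l
      = ∫ r in Set.Ioc 0 T, η i * Q r i l * η l := by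
    rw [integral_mul_const, integral_const_mul]
  have hi (i l) : Integrable (fun r => η i * Q r i l * η l) (volume.restrict (Set.Ioc 0 T)) :=
    ((hQi i l).const_mul _).mul_const _
  simp_rw [e]
  rw [← integral_finsetSum _ fun j _ => ?_]
  · rw [← Finset.sum_congr rfl fun i _ => integral_finsetSum _ fun l _ => hi i l,
      ← integral_finsetSum _ fun i _ => integrable_finsetSum _ fun l _ => hi i l]
    exact integral_congr_ae (Eventually.of_forall hquad)
  · refine IntegrableOn.mono_set (ContinuousOn.integrableOn_Icc ?_) Set.Ioc_subset_Icc_self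
    exact (continuousOn_finsetSum _ fun l _ =>
      continuousOn_const.mul (hY.continuousOn_kernel hb hσ l j)).pow 2

lemma posSemidef_gammaMatrix (hT : 0 ≤ T) (hY : IsFirstVariation b T Y)
    (hb : ContinuousOn b (Set.Icc 0 T)) (hσ : ContinuousOn σ (Set.Icc 0 T)) :
    (gammaMatrix σ T Y).PosSemidef := by
  refine PosSemidef.of_dotProduct_mulVec_nonneg ?_ fun θ => ?_
  · rw [IsHermitian, conjTranspose_eq_transpose_of_trivial, gammaMatrix]
    simp only [transpose_mul, transpose_transpose, Matrix.mul_assoc]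
    congr 2
    ext i j
    simp only [transpose_apply, of_apply]
    congr 1; ext r
    have : ((Y r)⁻¹ * (σ r * ((σ r)ᵀ * ((Y r)⁻¹)ᵀ)))ᵀ = (Y r)⁻¹ * (σ r * ((σ r)ᵀ * ((Y r)⁻¹)ᵀ)) := by
      simp only [transpose_mul, transpose_transpose, Matrix.mul_assoc]
    exact congrFun (congrFun this i) j
  · rw [star_trivial, dotProduct_gammaMatrix_mulVec hT hY hb hσ]
    exact Finset.sum_nonneg fun j _ => integral_nonneg fun r => sq_nonneg _

end Gamma

/-- The continuous linear automorphism of Euclidean space given by an invertible matrix. -/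
noncomputable def euclideanCLEOfIsUnit {m : ℕ} (A : Matrix (Fin m) (Fin m) ℝ) (hA : IsUnit A) :
    EuclideanSpace ℝ (Fin m) ≃L[ℝ] EuclideanSpace ℝ (Fin m) :=
  ContinuousLinearEquiv.equivOfInverse (toEuclideanCLM (n := Fin m) (𝕜 := ℝ) A)
    (toEuclideanCLM (n := Fin m) (𝕜 := ℝ) A⁻¹)
    (fun x => by
      rw [← mul_apply_eq_comp, ← map_mul, nonsing_inv_mul _ ((isUnit_iff_isUnit_det A).1 hA)]
      simp)
    (fun x => by
      rw [← mul_apply_eq_comp, ← map_mul, mul_nonsing_inv _ ((isUnit_iff_isUnit_det A).1 hA)]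
      simp)

/-- A nondegenerate centered Gaussian measure is the image of the standard one under an
automorphism `L`, here the square root of the covariance matrix `γ`, and `γ⁻¹` is then
`(L⁻¹)* L⁻¹`. -/
lemma exists_multivariateGaussian_eq_map {m : ℕ} {γ : Matrix (Fin m) (Fin m) ℝ}
    (hpsd : γ.PosSemidef) (hγ : IsUnit γ) :
    ∃ L : EuclideanSpace ℝ (Fin m) ≃L[ℝ] EuclideanSpace ℝ (Fin m),
      multivariateGaussian 0 γ = (stdGaussian (EuclideanSpace ℝ (Fin m))).map L ∧
      ∀ x, (L.symm : EuclideanSpace ℝ (Fin m) →L[ℝ] EuclideanSpace ℝ (Fin m)).adjoint (L.symm x)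
        = toEuclideanLin γ⁻¹ x := by
  have hC2 : CFC.sqrt γ * CFC.sqrt γ = γ := CFC.sqrt_mul_sqrt_self _ hpsd.nonneg
  have hCu : IsUnit (CFC.sqrt γ) := isUnit_of_mul_isUnit_left (hC2.symm ▸ hγ)
  have hCs : star (CFC.sqrt γ) = CFC.sqrt γ := (CFC.sqrt_nonneg γ).isSelfAdjoint
  refine ⟨euclideanCLEOfIsUnit (CFC.sqrt γ) hCu, ?_, fun x => ?_⟩
  · rw [multivariateGaussian]
    simp only [zero_add]
    rfl
  · have h1 : ((euclideanCLEOfIsUnit (CFC.sqrt γ) hCu).symm :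
        EuclideanSpace ℝ (Fin m) →L[ℝ] EuclideanSpace ℝ (Fin m))
        = toEuclideanCLM (n := Fin m) (𝕜 := ℝ) (CFC.sqrt γ)⁻¹ := rfl
    rw [h1, ← ContinuousLinearMap.star_eq_adjoint, ← map_star, star_eq_conjTranspose,
      conjTranspose_nonsing_inv, ← star_eq_conjTranspose, hCs]
    have hinv : γ⁻¹ = (CFC.sqrt γ)⁻¹ * (CFC.sqrt γ)⁻¹ := by
      rw [← Matrix.mul_inv_rev, hC2]
    rw [hinv, ← toEuclideanCLM_apply_eq, map_mul]
    rfl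

section Law

variable {Ω : Type*} [MeasurableSpace Ω] {P : Measure Ω} [IsProbabilityMeasure P]
    {m d : ℕ} {T : ℝ} {b Y : ℝ → Matrix (Fin m) (Fin m) ℝ} {σ : ℝ → Matrix (Fin m) (Fin d) ℝ}
    {B : Fin d → ℝ≥0 → Ω → ℝ} {X : ℝ → Ω → EuclideanSpace ℝ (Fin m)}

/-- Characteristic function of `U + ⟪X_T - Y_T X_0, θ⟫` for `U` independent of `B`: pathwise,
`X_T - Y_T X_0 = N_T + ∫_0^T Y_T Y_s⁻¹ b(s) N_s ds` with `N` the martingale part of `X`. -/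
lemma IsSolution.integral_cexp (hX : IsSolution P B b σ T X) (hT : 0 < T)
    (hB : IsStdBrownianMotion B P) (hb : ContinuousOn b (Set.Icc 0 T))
    (hσ : ContinuousOn σ (Set.Icc 0 T)) (hY : IsFirstVariation b T Y)
    {U : Ω → ℝ} (hU : AEMeasurable U P)
    (hind : IndepFun U (fun (ω : Ω) (j : Fin d) (t : ℝ≥0) => B j t ω) P)
    (θ : EuclideanSpace ℝ (Fin m)) :
    ∫ ω, Complex.exp ((U ω + inner ℝ (X T ω - toEuclideanLin (Y T) (X 0 ω)) θ : ℝ)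
        * Complex.I) ∂P
      = (∫ ω, Complex.exp (U ω * Complex.I) ∂P) *
        Complex.exp ((-(θ ⬝ᵥ gammaMatrix σ T Y *ᵥ θ) / 2 : ℝ)) := by
  let N : ℝ → Ω → EuclideanSpace ℝ (Fin m) := fun t ω =>
    X t ω - X 0 ω - ∫ s in (0 : ℝ)..t, toEuclideanLin (b s) (X s ω)
  let K : ℝ → Matrix (Fin m) (Fin m) ℝ := fun s => Y T * (Y s)⁻¹ * b s
  have hK : ContinuousOn K (Set.Icc 0 T) := hY.continuousOn_resolvent hb
  have hKe (l i) : ContinuousOn (fun s => K s l i) (Set.Icc 0 T) :=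
    (continuous_apply_apply l i).comp_continuousOn hK
  let κ : Fin m → ℝ → ℝ := fun i s => ∑ l, θ l * K s l i
  have hκ (i) : ContinuousOn (κ i) (Set.Icc 0 T) :=
    continuousOn_finsetSum _ fun l _ => continuousOn_const.mul (hKe l i)
  have hpath : ∀ᵐ ω ∂P, ContinuousOn (fun t => N t ω) (Set.Icc 0 T) ∧
      X T ω = toEuclideanLin (Y T) (X 0 ω) + (N T ω +
        ∫ s in (0 : ℝ)..T, toEuclideanLin (K s) (N s ω)) := by
    filter_upwards [hX.continuousOn] with ω hω
    exact hY.eq_of_path hT.le hb hω (N := fun t => N t ω) fun t _ => rfl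
  have hcoord (i : Fin m) : Continuous fun x : EuclideanSpace ℝ (Fin m) => x i := by fun_prop
  have hNc : ∀ᵐ ω ∂P, ∀ i, ContinuousOn (fun t => N t ω i) (Set.Icc 0 T) := by
    filter_upwards [hpath] with ω hω i using (hcoord i).comp_continuousOn hω.1
  have hNI : ∀ t ∈ Set.Icc 0 T, ∃ I : Fin m → Fin d → Ω → ℝ,
      (∀ i j, IsItoIntegral P (B j) (fun s => σ s i j) t (I i j)) ∧
      ∀ᵐ ω ∂P, ∀ i, N t ω i = ∑ j, I i j ω := by
    intro t ht
    obtain ⟨I, hI, hae⟩ := hX.equation t ht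
    refine ⟨I, hI, ?_⟩
    filter_upwards [hae] with ω hω i
    have : N t ω = WithLp.toLp 2 (fun i => ∑ j, I i j ω) := by
      simp only [N]
      rw [hω]
      abel
    rw [this]
  have key := integral_cexp_add_functional hT hB hU hind hσ hNc hNI θ.ofLp hκ
  rw [dotProduct_gammaMatrix_mulVec hT.le hY hb hσ]
  refine Eq.trans (integral_congr_ae ?_) (key.trans ?_)
  · filter_upwards [hpath] with ω hω
    have hcont : ContinuousOn (fun s => toEuclideanLin (K s) (N s ω)) (Set.Icc 0 T) :=
      (continuousOn_toEuclideanCLM hK).clm_apply hω.1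
    have hinn : ∫ s in Set.Ioc 0 T, inner ℝ θ (toEuclideanLin (K s) (N s ω))
        = ∑ i, ∫ s in Set.Ioc 0 T, κ i s * N s ω i := by
      rw [← integral_finsetSum _ fun i _ => ?_]
      · refine integral_congr_ae (Eventually.of_forall fun s => ?_)
        simp only [κ, PiLp.inner_apply, toLpLin_apply, mulVec, dotProduct, RCLike.inner_apply,
          conj_trivial, Finset.sum_mul]
        rw [Finset.sum_comm]
        refine Finset.sum_congr rfl fun i _ => Finset.sum_congr rfl fun l _ => ?_
        ring
      · exact IntegrableOn.mono_set (((hκ i).mul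
          ((hcoord i).comp_continuousOn hω.1)).integrableOn_Icc) Set.Ioc_subset_Icc_self
    have hXe : X T ω - toEuclideanLin (Y T) (X 0 ω) =
        N T ω + ∫ s in (0 : ℝ)..T, toEuclideanLin (K s) (N s ω) := by
      rw [hω.2, add_sub_cancel_left]
    have hi : inner ℝ (X T ω - toEuclideanLin (Y T) (X 0 ω)) θ =
        ∑ i, (θ i * N T ω i + ∫ s in Set.Ioc 0 T, κ i s * N s ω i) := by
      rw [hXe, real_inner_comm, inner_add_right, intervalIntegral.integral_of_le hT.le,
        ← integral_inner (hcont.integrableOn_Icc.mono_set Set.Ioc_subset_Icc_self), hinn,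
        Finset.sum_add_distrib]
      congr 1
      simp [PiLp.inner_apply, mul_comm]
    rw [hi]
  · congr 5
    refine Finset.sum_congr rfl fun j _ => setIntegral_congr_fun measurableSet_Ioc fun r hr => ?_
    simp only
    congr 1
    -- the weight of `σ r i j` is the `i`-th coordinate of `θᵀ Y_T Y_r⁻¹`
    have hw (i : Fin m) : θ i + ∫ s in Set.Ioc 0 T, (Set.Ici r).indicator (κ i) s
        = ∑ l, θ l * (Y T * (Y r)⁻¹) l i := by
      have h1 : Set.Ioc 0 T ∩ Set.Ici r = Set.Icc r T := by
        ext s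
        exact ⟨fun h => ⟨h.2, h.1.2⟩, fun h => ⟨⟨hr.1.trans_le h.1, h.2⟩, h.1⟩⟩
      rw [setIntegral_indicator measurableSet_Ici, h1, integral_Icc_eq_integral_Ioc,
        ← intervalIntegral.integral_of_le hr.2]
      simp only [κ]
      rw [intervalIntegral.integral_finsetSum fun l _ => ?_]
      · simp_rw [intervalIntegral.integral_const_mul, K,
          hY.integral_resolvent hb ⟨hr.1.le, hr.2⟩, Matrix.sub_apply, mul_sub,
          Finset.sum_sub_distrib]
        simp [Matrix.one_apply]
      · exact (((continuousOn_const.mul (hKe l i)).mono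
          (Set.Icc_subset_Icc_left hr.1.le)).intervalIntegrable_of_Icc hr.2)
    simp_rw [hw, Matrix.mul_apply (M := Y T * (Y r)⁻¹), Finset.sum_mul, Finset.mul_sum]
    rw [Finset.sum_comm]
    simp only [mul_assoc]

/-- The pair `(X_0, X_T)` has the law of `(x, Y_T x + g)` with `x` distributed as `X_0` and `g`
an independent centered Gaussian vector with covariance `γ`. -/
theorem IsSolution.map_pair (hX : IsSolution P B b σ T X) (hT : 0 < T)
    (hB : IsStdBrownianMotion B P) (hb : ContinuousOn b (Set.Icc 0 T))
    (hσ : ContinuousOn σ (Set.Icc 0 T)) (hY : IsFirstVariation b T Y)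
    (hX0 : AEMeasurable (X 0) P)
    (hind : IndepFun (X 0) (fun (ω : Ω) (j : Fin d) (t : ℝ≥0) => B j t ω) P) :
    P.map (fun ω => (X 0 ω, X T ω - toEuclideanLin (Y T) (X 0 ω))) =
      (P.map (X 0)).prod (multivariateGaussian 0 (gammaMatrix σ T Y)) := by
  have hXT := hX.aemeasurable T ⟨hT.le, le_rfl⟩
  have hlin : Measurable (toEuclideanLin (Y T)) :=
    (toEuclideanCLM (n := Fin m) (𝕜 := ℝ) (Y T)).continuous.measurable
  have hG : AEMeasurable (fun ω => X T ω - toEuclideanLin (Y T) (X 0 ω)) P :=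
    hXT.sub (hlin.comp_aemeasurable hX0)
  have := Measure.isProbabilityMeasure_map hX0 (μ := P)
  have := Measure.isProbabilityMeasure_map (hX0.prodMk hG) (μ := P)
  refine charFun_eq_prod_iff.1 fun t => ?_
  rw [charFun_apply, integral_map (by fun_prop) (by fun_prop),
    integral_map (hX0.prodMk hG) (by fun_prop),
    charFun_multivariateGaussian (posSemidef_gammaMatrix hT.le hY hb hσ), charFun_apply,
    integral_map hX0 (by fun_prop)]
  have h := hX.integral_cexp hT hB hb hσ hY (U := fun ω => inner ℝ (X 0 ω) t.ofLp.1)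
    (by fun_prop) (hind.comp (φ := fun x => inner ℝ x t.ofLp.1) (ψ := id) (by fun_prop)
      measurable_id) t.ofLp.2
  simp only [WithLp.prod_inner_apply]
  rw [h]
  congr 2
  simp [neg_div]

end Law

end LinearSDE

theorem mainTheorem1 {Ω : Type*} [MeasurableSpace Ω] (P : Measure Ω) [IsProbabilityMeasure P]
    {m d : ℕ} (T : ℝ) (hT : 0 < T)
    (b : ℝ → Matrix (Fin m) (Fin m) ℝ) (hb : ContinuousOn b (Set.Icc 0 T))
    (σ : ℝ → Matrix (Fin m) (Fin d) ℝ) (hσ : ContinuousOn σ (Set.Icc 0 T))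
    (B : Fin d → ℝ≥0 → Ω → ℝ) (hB : LinearSDE.IsStdBrownianMotion B P)
    (pdata : Measure (EuclideanSpace ℝ (Fin m)))
    (X : ℝ → Ω → EuclideanSpace ℝ (Fin m)) (hX : LinearSDE.IsSolution P B b σ T X)
    (hX0 : HasLaw (X 0) pdata P)
    (hind : IndepFun (X 0) (fun (ω : Ω) (j : Fin d) (t : ℝ≥0) => B j t ω) P)
    (Y : ℝ → Matrix (Fin m) (Fin m) ℝ) (hY : LinearSDE.IsFirstVariation b T Y)
    (hγ : IsUnit (LinearSDE.gammaMatrix σ T Y)) :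
    ∃ p : EuclideanSpace ℝ (Fin m) → ℝ,
      ContDiff ℝ ((⊤ : ℕ∞) : WithTop ℕ∞) p ∧ (∀ y, 0 < p y) ∧
      P.map (X T) = volume.withDensity (fun y => ENNReal.ofReal (p y)) ∧
      ∀ᵐ y ∂(volume : Measure (EuclideanSpace ℝ (Fin m))),
        Integrable (fun x => x) (condDistrib (X 0) (X T) P y) ∧
        HasGradientAt (fun z => Real.log (p z))
          (-(toEuclideanLin (LinearSDE.gammaMatrix σ T Y)⁻¹
            (y - toEuclideanLin (Y T) (∫ x, x ∂(condDistrib (X 0) (X T) P y))))) y := by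
  have hTm : T ∈ Set.Icc 0 T := ⟨hT.le, le_rfl⟩
  have hpsd := LinearSDE.posSemidef_gammaMatrix hT.le hY hb hσ
  obtain ⟨L, hL, hLadj⟩ := LinearSDE.exists_multivariateGaussian_eq_map hpsd hγ
  have hpair := hX.map_pair hT hB hb hσ hY hX0.aemeasurable hind
  have hXT := hX.aemeasurable T hTm
  have hlin : Measurable (toEuclideanLin (Y T)) :=
    (toEuclideanCLM (n := Fin m) (𝕜 := ℝ) (Y T)).continuous.measurable
  let M := LinearSDE.euclideanCLEOfIsUnit (Y T) (hY.isUnit hb hTm)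
  have hprob := Measure.isProbabilityMeasure_map hX0.aemeasurable (μ := P)
  have hlaw : P.map (fun ω => (X 0 ω, X T ω)) =
      ((P.map (X 0)).prod (stdGaussian (EuclideanSpace ℝ (Fin m)))).map
        (fun z => (z.1, M z.1 + L z.2)) := by
    have h1 : P.map (fun ω => (X 0 ω, X T ω)) =
        (P.map (fun ω => (X 0 ω, X T ω - toEuclideanLin (Y T) (X 0 ω)))).map
          (fun z => (z.1, M z.1 + z.2)) := by
      have hX0' := hX0.aemeasurable
      have hXG : AEMeasurable (fun ω => (X 0 ω, X T ω - toEuclideanLin (Y T) (X 0 ω))) P :=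
        hX0'.prodMk (hXT.sub (hlin.comp_aemeasurable hX0'))
      rw [AEMeasurable.map_map_of_aemeasurable (by fun_prop) hXG]
      congr 1
      ext1 ω
      simp only [Function.comp_apply, Prod.mk.injEq, true_and]
      exact (add_sub_cancel (toEuclideanLin (Y T) (X 0 ω)) (X T ω)).symm
    have h3 : (P.map (X 0)).prod ((stdGaussian (EuclideanSpace ℝ (Fin m))).map L)
        = ((P.map (X 0)).prod (stdGaussian (EuclideanSpace ℝ (Fin m)))).map (Prod.map id L) := by
      rw [← Measure.map_prod_map _ _ measurable_id (by fun_prop), Measure.map_id]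
    rw [h1, hpair, hL, h3, Measure.map_map (by fun_prop) (by fun_prop)]
    rfl
  obtain ⟨p, hp1, hp2, hp3, hp4⟩ :=
    LinearSDE.exists_density_of_map_eq L M (P.map (X 0)) hX0.aemeasurable hXT hlaw
  refine ⟨p, hp1, hp2, hp3, ?_⟩
  filter_upwards [hp4] with y hy
  refine ⟨hy.1, ?_⟩
  have hgrad := hy.2
  rw [hLadj] at hgrad
  exact hgrad
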